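/- **Setting.** For a periodic distribution $u=\sum_{n\in\mathbb Z}\widehat u(n)e^{inx}$ on $\mathbb T=\mathbb R/2\pi\mathbb Z$ put $\langle n\rangle:=\max(1,|n|)$. For $\beta\in\mathbb R$ let $H^\beta_c$ be the space of complex-valued $u$ with $\|u\|_\beta^2:=\sum_n\langle n\rangle^{2\beta}|\widehat u(n)|^2<\infty$, let $H^{\beta,\sqrt{\log}}_c$ be the space of those with $\|u\|_{\beta,\sqrt{\log}}^2:=\sum_n\langle n\rangle^{2\beta}\log(\langle n\rangle+1)|\widehat u(n)|^2<\infty$, and let $H^\beta_+:=\{f\in H^\beta_c: \widehat f(n)=0\ \forall n<0\}$, with the norm of $H^\beta_c$. Put $L^2_c:=H^0_c$, $\|\cdot\|:=\|\cdot\|_0$. Let $\Pi\sum_{n\in\mathbb Z}\widehat v(n)e^{inx}:=\sum_{n\ge0}\widehat v(n)e^{inx}$, $D:=-i\partial_x$, and, for $u\in H^{-1/2,\sqrt{\log}}_c$, $T_uf:=\Pi(uf)$ and $L_uf:=Df-T_uf$, where the product has the Fourier coefficients $\widehat{uf}(n)=\sum_k\widehat u(n-k)\widehat f(k)$. **Theorem.**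 There is a constant $K_0>0$ such that $$uv\in H^{-1/2}_c\quad\text{and}\quad \|uv\|_{-1/2}\le K_0\,\|u\|_{-1/2,\sqrt{\log}}\,\|v\|_{1/2}\qquad\text{for all } u\in H^{-1/2,\sqrt{\log}}_c,\ v\in H^{1/2}_c. \tag{1}$$ For every $u\in H^{-1/2,\sqrt{\log}}_c$ the expression $L_u=D-T_u$ defines a closed operator on $H^{-1/2}_+$ with domain $H^{1/2}_+$. This operator has a compact resolvent (its resolvent set is non-empty and $(L_u-\lambda)^{-1}$ is a compact operator on $H^{-1/2}_+$ for every $\lambda$ in the resolvent set), and hence a discrete spectrum (the spectrum has finitely many points in every disc, and each of them is an eigenvalue of finite algebraic multiplicity). Moreover, there is a constant $C_0>0$ such that the following holds for every $K_0>0$ that satisfies (1) and every $u_0\in L^2_c$. Set $$B(u_0):=\Big\{u\in H^{-1/2,\sqrt{\log}}_c:\ \|u-u_0\|_{-1/2,\sqrt{\log}}<\frac1{4K_0}\Big\},\qquad \Lambda_{u_0}:=\big\{\lambda\in\mathbb C:\ \operatorname{Re}\lambda<-\big(1+C_0\|u_0\|(1+\|u_0\|)\big)\big\}.$$ (i) For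 every $u\in B(u_0)$ the half-plane $\Lambda_{u_0}$ is contained in the resolvent set of $L_u$. (ii) The map $(u,\lambda)\mapsto(L_u-\lambda)^{-1}$, $B(u_0)\times\Lambda_{u_0}\to\mathcal L\big(H^{-1/2}_+,H^{1/2}_+\big)$, is well-defined and analytic. -/

import Mathlib

noncomputable section

namespace LaxBO

/-! ### Periodic distributions through their Fourier coefficients -/

/-- A formal Fourier series `∑ n, û(n) e^{inx}` on the torus `ℝ / 2πℤ`, recorded by its Fourier
coefficients `û : ℤ → ℂ`.  A periodic distribution is determined by its Fourier coefficients, and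
the periodic distributions are exactly the series whose coefficients grow at most polynomially;
every element of a Sobolev space `Sob β γ` below has this property. -/
def FourierSeries : Type := ℤ → ℂ

instance : AddCommGroup FourierSeries := inferInstanceAs (AddCommGroup (ℤ → ℂ))
instance : Module ℂ FourierSeries := inferInstanceAs (Module ℂ (ℤ → ℂ))
instance : CoeFun FourierSeries (fun _ => ℤ → ℂ) := ⟨fun u => u⟩

@[simp] theorem FourierSeries.add_apply (u v : FourierSeries) (n : ℤ) : (u + v) n = u n + v n := rfl
@[simp] theorem FourierSeries.sub_apply (u v : FourierSeries) (n : ℤ) : (u - v) n = u n - v n := rfl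
@[simp] theorem FourierSeries.smul_apply (c : ℂ) (u : FourierSeries) (n : ℤ) :
    (c • u) n = c * u n := rfl
@[simp] theorem FourierSeries.zero_apply (n : ℤ) : (0 : FourierSeries) n = 0 := rfl

/-- `⟨n⟩ = max 1 |n|`. -/
def bracket (n : ℤ) : ℝ := max 1 |(n : ℝ)|

theorem one_le_bracket (n : ℤ) : 1 ≤ bracket n := le_max_left _ _

theorem bracket_pos (n : ℤ) : 0 < bracket n := one_pos.trans_le (one_le_bracket n)

/-- The weight `⟨n⟩^{2β} log(⟨n⟩ + 1)^γ`. -/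
def weight (β : ℝ) (γ : ℕ) (n : ℤ) : ℝ := bracket n ^ (2 * β) * Real.log (bracket n + 1) ^ γ

theorem weight_pos (β : ℝ) (γ : ℕ) (n : ℤ) : 0 < weight β γ n := by
  have := one_le_bracket n
  exact mul_pos (Real.rpow_pos_of_pos (bracket_pos n) _) (pow_pos (Real.log_pos (by linarith)) _)

/-- The sequence `⟨n⟩^β log(⟨n⟩ + 1)^{γ/2} û(n)`. -/
def weighted (β : ℝ) (γ : ℕ) : FourierSeries →ₗ[ℂ] (ℤ → ℂ) where
  toFun u := fun n => (Real.sqrt (weight β γ n) : ℂ) * u n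
  map_add' u v := by
    funext n
    exact mul_add _ _ _
  map_smul' c u := by
    funext n
    exact mul_left_comm _ _ _

theorem weighted_norm_sq (β : ℝ) (γ : ℕ) (u : FourierSeries) (n : ℤ) :
    ‖weighted β γ u n‖ ^ 2 = weight β γ n * ‖u n‖ ^ 2 := by
  change ‖(Real.sqrt (weight β γ n) : ℂ) * u n‖ ^ 2 = _
  rw [norm_mul, mul_pow, Complex.norm_real, Real.norm_eq_abs, sq_abs,
    Real.sq_sqrt (weight_pos β γ n).le]

theorem memℓp_weighted_iff {β : ℝ} {γ : ℕ} {u : FourierSeries} :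
    Memℓp (weighted β γ u) 2 ↔ Summable (fun n : ℤ => weight β γ n * ‖u n‖ ^ 2) := by
  rw [memℓp_gen_iff (by norm_num)]
  refine summable_congr fun n => ?_
  rw [← weighted_norm_sq]
  norm_num

/-- The condition `∑ n, ⟨n⟩^{2β} log(⟨n⟩ + 1)^γ |û(n)|² < ∞`. -/
structure FiniteNorm (β : ℝ) (γ : ℕ) (u : FourierSeries) : Prop where
  summable : Summable (fun n : ℤ => weight β γ n * ‖u n‖ ^ 2)

theorem memℓp_iff_finiteNorm {β : ℝ} {γ : ℕ} {u : FourierSeries} :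
    Memℓp (weighted β γ u) 2 ↔ FiniteNorm β γ u :=
  memℓp_weighted_iff.trans ⟨fun h => ⟨h⟩, fun h => h.summable⟩

/-- The Sobolev space of all `u` with `∑ n, ⟨n⟩^{2β} log(⟨n⟩ + 1)^γ |û(n)|² < ∞`; the case `γ = 0`
is `H^β_c`, and the case `γ = 1` is `H^{β,√log}_c`. -/
def Sob (β : ℝ) (γ : ℕ) : Submodule ℂ FourierSeries where
  carrier := {u | FiniteNorm β γ u}
  zero_mem' := by
    refine memℓp_iff_finiteNorm.1 ?_
    rw [map_zero]
    exact zero_memℓp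
  add_mem' := by
    intro u v hu hv
    refine memℓp_iff_finiteNorm.1 ?_
    rw [map_add]
    exact Memℓp.add (memℓp_iff_finiteNorm.2 hu) (memℓp_iff_finiteNorm.2 hv)
  smul_mem' := by
    intro c u hu
    refine memℓp_iff_finiteNorm.1 ?_
    rw [map_smul]
    exact Memℓp.const_smul (memℓp_iff_finiteNorm.2 hu) c

theorem mem_Sob_iff {β : ℝ} {γ : ℕ} {u : FourierSeries} :
    u ∈ Sob β γ ↔ Summable (fun n : ℤ => weight β γ n * ‖u n‖ ^ 2) :=
  ⟨fun h => h.summable, fun h => ⟨h⟩⟩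

/-- The isometric linear map of `Sob β γ` to `ℓ²(ℤ)` that defines the norm. -/
def toEll2 (β : ℝ) (γ : ℕ) : Sob β γ →ₗ[ℂ] lp (fun _ : ℤ => ℂ) 2 where
  toFun u := ⟨weighted β γ u.1, memℓp_iff_finiteNorm.2 u.2⟩
  map_add' u v := Subtype.ext (map_add (weighted β γ) u.1 v.1)
  map_smul' c u := Subtype.ext (map_smul (weighted β γ) c u.1)

theorem toEll2_injective (β : ℝ) (γ : ℕ) : Function.Injective (toEll2 β γ) := by
  intro u v h
  apply Subtype.ext
  funext n
  have h1 : (Real.sqrt (weight β γ n) : ℂ) * u.1 n = (Real.sqrt (weight β γ n) : ℂ) * v.1 n :=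
    congrFun (congrArg Subtype.val h) n
  have h2 : (Real.sqrt (weight β γ n) : ℂ) ≠ 0 := by
    exact_mod_cast (Real.sqrt_pos.2 (weight_pos β γ n)).ne'
  exact mul_left_cancel₀ h2 h1

instance (β : ℝ) (γ : ℕ) : NormedAddCommGroup (Sob β γ) :=
  NormedAddCommGroup.induced (Sob β γ) (lp (fun _ : ℤ => ℂ) 2) (toEll2 β γ) (toEll2_injective β γ)

instance (β : ℝ) (γ : ℕ) : NormedSpace ℂ (Sob β γ) :=
  NormedSpace.induced ℂ (Sob β γ) (lp (fun _ : ℤ => ℂ) 2) (toEll2 β γ)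

/-- The norm of `Sob β γ` is `(∑ n, ⟨n⟩^{2β} log(⟨n⟩ + 1)^γ |û(n)|²)^{1/2}`. -/
theorem Sob.norm_sq {β : ℝ} {γ : ℕ} (u : Sob β γ) :
    ‖u‖ ^ 2 = ∑' n : ℤ, weight β γ n * ‖u.1 n‖ ^ 2 := by
  have h := lp.norm_rpow_eq_tsum (p := 2) (by norm_num) (toEll2 β γ u)
  have h1 : ‖toEll2 β γ u‖ = ‖u‖ := rfl
  rw [h1] at h
  norm_num at h
  rw [h]
  exact tsum_congr fun n => weighted_norm_sq β γ u.1 n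

theorem Sob.mono {β β' : ℝ} {γ γ' : ℕ} (h : ∀ n, weight β' γ' n ≤ weight β γ n)
    {u : FourierSeries} (hu : u ∈ Sob β γ) : u ∈ Sob β' γ' :=
  mem_Sob_iff.2 ((mem_Sob_iff.1 hu).of_nonneg_of_le
    (fun n => mul_nonneg (weight_pos β' γ' n).le (sq_nonneg ‖u n‖))
    (fun n => mul_le_mul_of_nonneg_right (h n) (sq_nonneg ‖u n‖)))

theorem Sob.norm_mono {β β' : ℝ} {γ γ' : ℕ} (h : ∀ n, weight β' γ' n ≤ weight β γ n)
    (u : Sob β γ) : ‖(⟨u.1, Sob.mono h u.2⟩ : Sob β' γ')‖ ≤ 1 * ‖u‖ := by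
  rw [one_mul]
  refine le_of_sq_le_sq ?_ (norm_nonneg _)
  rw [Sob.norm_sq, Sob.norm_sq]
  exact (mem_Sob_iff.1 (Sob.mono h u.2)).tsum_le_tsum
    (fun n => mul_le_mul_of_nonneg_right (h n) (sq_nonneg ‖u.1 n‖)) (mem_Sob_iff.1 u.2)

/-- Comparison of weights gives a norm-decreasing inclusion. -/
def incl {β β' : ℝ} {γ γ' : ℕ} (h : ∀ n, weight β' γ' n ≤ weight β γ n) :
    Sob β γ →L[ℂ] Sob β' γ' :=
  LinearMap.mkContinuous
    (Submodule.inclusion (fun _ hu => Sob.mono h hu) : Sob β γ →ₗ[ℂ] Sob β' γ') 1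
    (Sob.norm_mono h)

/-- The Hardy space `H^β_+` of all `f ∈ H^β_c` with `f̂(n) = 0` for `n < 0`, with the norm of
`H^β_c`. -/
def Hardy (β : ℝ) : Submodule ℂ (Sob β 0) where
  carrier := {f | ∀ n : ℤ, n < 0 → f.1 n = 0}
  zero_mem' := fun _ _ => rfl
  add_mem' := by
    intro f g hf hg n hn
    change f.1 n + g.1 n = 0
    rw [hf n hn, hg n hn, add_zero]
  smul_mem' := by
    intro c f hf n hn
    change c * f.1 n = 0
    rw [hf n hn, mul_zero]

theorem mem_Hardy_iff {β : ℝ} {f : Sob β 0} : f ∈ Hardy β ↔ ∀ n : ℤ, n < 0 → f.1 n = 0 := Iff.rfl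

theorem incl_apply {β β' : ℝ} {γ γ' : ℕ} (h : ∀ n, weight β' γ' n ≤ weight β γ n) (u : Sob β γ) :
    (incl h u).1 = u.1 := rfl

theorem weight_zero_le (n : ℤ) : weight (-1 / 2) 1 n ≤ weight 0 0 n := by
  have h1 := one_le_bracket n
  have h0 := bracket_pos n
  have h2 : Real.log (bracket n + 1) ≤ bracket n := by
    have := Real.log_le_sub_one_of_pos (x := bracket n + 1) (by linarith)
    linarith
  have h3 : (2 : ℝ) * (-1 / 2) = -1 := by norm_num
  simp only [weight, pow_one, pow_zero, mul_one, mul_zero, Real.rpow_zero, h3, Real.rpow_neg_one]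
  rw [inv_mul_le_iff₀ h0, mul_one]
  exact h2

theorem weight_half_le (n : ℤ) : weight (-1 / 2) 0 n ≤ weight (1 / 2) 0 n := by
  simp only [weight, pow_zero, mul_one]
  exact Real.rpow_le_rpow_of_exponent_le (one_le_bracket n) (by norm_num)

/-- The inclusion `L²_c ⊆ H^{-1/2,√log}_c`. -/
def inclL2 : Sob 0 0 →L[ℂ] Sob (-1 / 2) 1 := incl weight_zero_le

/-- The inclusion `H^{1/2}_+ ⊆ H^{-1/2}_+`. -/
def inclHardy : Hardy (1 / 2) →L[ℂ] Hardy (-1 / 2) :=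
  ((incl weight_half_le).comp (Hardy (1 / 2)).subtypeL).codRestrict (Hardy (-1 / 2))
    (fun f => mem_Hardy_iff.2 fun n hn => by
      change (incl weight_half_le f.1).1 n = 0
      rw [incl_apply]
      exact mem_Hardy_iff.1 f.2 n hn)

/-! ### The Lax operator -/

/-- The product of two periodic distributions: `(uv)^(n) = ∑ k, û(n - k) v̂(k)`. -/
def mul (u v : FourierSeries) : FourierSeries := fun n => ∑' k : ℤ, u (n - k) * v k

/-- The Szegő projector. -/
def szego (v : FourierSeries) : FourierSeries := fun n => if 0 ≤ n then v n else 0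

/-- The operator `D = -i ∂_x`. -/
def opD (v : FourierSeries) : FourierSeries := fun n => (n : ℂ) * v n

/-- The Toeplitz operator `T_u f = Π(uf)`. -/
def toeplitz (u f : FourierSeries) : FourierSeries := szego (mul u f)

/-- The pseudo-differential expression `L_u f = D f - T_u f`. -/
def laxExpr (u f : FourierSeries) : FourierSeries := opD f - toeplitz u f

theorem bracket_le_mul (n k : ℤ) : bracket (n - k) ≤ (1 + |(n : ℝ)|) * bracket k := by
  have hk1 : 1 ≤ bracket k := one_le_bracket k
  have hk2 : |(k : ℝ)| ≤ bracket k := le_max_right _ _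
  have hn := abs_nonneg (n : ℝ)
  have hprod : |(n : ℝ)| ≤ |(n : ℝ)| * bracket k := le_mul_of_one_le_right hn hk1
  refine max_le ?_ ?_
  · linarith
  · push_cast
    have := abs_sub (n : ℝ) (k : ℝ)
    linarith

theorem summable_mul {u v : FourierSeries} (hu : u ∈ Sob (-1 / 2) 0) (hv : v ∈ Sob (1 / 2) 0)
    (n : ℤ) : Summable (fun k : ℤ => u (n - k) * v k) := by
  have hu1 := (mem_Sob_iff.1 hu).comp_injective (i := fun k : ℤ => n - k)
    (fun a b h => sub_right_injective h)
  have hv1 := (mem_Sob_iff.1 hv).mul_left (1 + |(n : ℝ)|)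
  refine Summable.of_norm_bounded (hu1.add hv1) fun k => ?_
  have e1 : (2 : ℝ) * (-1 / 2) = -1 := by norm_num
  have e2 : (2 : ℝ) * (1 / 2) = 1 := by norm_num
  simp only [Function.comp, weight, pow_zero, mul_one, e1, e2, Real.rpow_neg_one, Real.rpow_one]
  rw [norm_mul]
  set a := ‖u (n - k)‖
  set b := ‖v k‖
  have hp : 0 < bracket (n - k) := bracket_pos _
  have hle : bracket (n - k) * b ^ 2 ≤ (1 + |(n : ℝ)|) * bracket k * b ^ 2 :=
    mul_le_mul_of_nonneg_right (bracket_le_mul n k) (sq_nonneg b)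
  have key : a * b ≤ (bracket (n - k))⁻¹ * a ^ 2 + bracket (n - k) * b ^ 2 := by
    have h1 : (bracket (n - k))⁻¹ * a ^ 2 + bracket (n - k) * b ^ 2 - 2 * (a * b)
        = (bracket (n - k))⁻¹ * (a - bracket (n - k) * b) ^ 2 := by
      field_simp
      ring
    have h2 : 0 ≤ (bracket (n - k))⁻¹ * (a - bracket (n - k) * b) ^ 2 := by positivity
    have h3 : 0 ≤ a * b := mul_nonneg (norm_nonneg _) (norm_nonneg _)
    linarith
  linarith

theorem weight_log_ge (n : ℤ) (β : ℝ) : Real.log 2 * weight β 0 n ≤ weight β 1 n := by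
  have h1 := one_le_bracket n
  simp only [weight, pow_zero, pow_one, mul_one]
  rw [mul_comm]
  refine mul_le_mul_of_nonneg_left ?_ (Real.rpow_nonneg (bracket_pos n).le _)
  exact Real.log_le_log (by norm_num) (by linarith)

/-- `H^{β,√log}_c ⊆ H^β_c`. -/
theorem mem_of_mem_log {β : ℝ} {u : FourierSeries} (hu : u ∈ Sob β 1) : u ∈ Sob β 0 := by
  rw [mem_Sob_iff] at hu ⊢
  have hl : 0 < Real.log 2 := Real.log_pos (by norm_num)
  refine (hu.mul_left (Real.log 2)⁻¹).of_nonneg_of_le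
    (fun n => mul_nonneg (weight_pos _ _ n).le (sq_nonneg _)) fun n => ?_
  rw [← mul_assoc]
  refine mul_le_mul_of_nonneg_right ?_ (sq_nonneg _)
  rw [inv_mul_eq_div, le_div_iff₀ hl, mul_comm]
  exact weight_log_ge n β

theorem laxExpr_add {u f g : FourierSeries} (hu : u ∈ Sob (-1 / 2) 0) (hf : f ∈ Sob (1 / 2) 0)
    (hg : g ∈ Sob (1 / 2) 0) : laxExpr u (f + g) = laxExpr u f + laxExpr u g := by
  funext n
  have h : mul u (f + g) n = mul u f n + mul u g n := by
    simp only [mul, FourierSeries.add_apply, mul_add]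
    exact (summable_mul hu hf n).tsum_add (summable_mul hu hg n)
  simp only [laxExpr, opD, toeplitz, szego, FourierSeries.add_apply, FourierSeries.sub_apply]
  split_ifs
  · rw [h]
    ring
  · ring

theorem laxExpr_smul (c : ℂ) (u f : FourierSeries) : laxExpr u (c • f) = c • laxExpr u f := by
  funext n
  have h : mul u (c • f) n = c * mul u f n := by
    simp only [mul, FourierSeries.smul_apply, mul_left_comm _ c]
    exact tsum_mul_left
  simp only [laxExpr, opD, toeplitz, szego, FourierSeries.smul_apply, FourierSeries.sub_apply]
  split_ifs
  · rw [h]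
    ring
  · ring

theorem laxExpr_zero (u : FourierSeries) : laxExpr u 0 = 0 := by
  have h := laxExpr_smul 0 u 0
  rwa [zero_smul, zero_smul] at h

theorem laxExpr_neg_freq {u f : FourierSeries} {n : ℤ} (hn : n < 0) (hf : f n = 0) :
    laxExpr u f n = 0 := by
  simp [laxExpr, opD, toeplitz, szego, not_le.2 hn, hf]

/-- The Lax operator `L_u = D - T_u` as an unbounded operator on `H^{-1/2}_+`: it is defined at
those `f ∈ H^{1/2}_+` for which `D f - T_u f` is an element of `H^{-1/2}_+`.  That this holds
for every `f ∈ H^{1/2}_+` is a claim about `L_u`, not a part of the definition. -/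
def lax (u : Sob (-1 / 2) 1) : Hardy (-1 / 2) →ₗ.[ℂ] Hardy (-1 / 2) where
  domain :=
    { carrier := {f | f.1.1 ∈ Sob (1 / 2) 0 ∧ laxExpr u.1 f.1.1 ∈ Sob (-1 / 2) 0}
      zero_mem' := by
        refine ⟨(Sob (1 / 2) 0).zero_mem, ?_⟩
        change laxExpr u.1 0 ∈ Sob (-1 / 2) 0
        rw [laxExpr_zero]
        exact (Sob (-1 / 2) 0).zero_mem
      add_mem' := by
        intro f g hf hg
        refine ⟨(Sob (1 / 2) 0).add_mem hf.1 hg.1, ?_⟩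
        change laxExpr u.1 (f.1.1 + g.1.1) ∈ Sob (-1 / 2) 0
        rw [laxExpr_add (mem_of_mem_log u.2) hf.1 hg.1]
        exact (Sob (-1 / 2) 0).add_mem hf.2 hg.2
      smul_mem' := by
        intro c f hf
        refine ⟨(Sob (1 / 2) 0).smul_mem c hf.1, ?_⟩
        change laxExpr u.1 (c • f.1.1) ∈ Sob (-1 / 2) 0
        rw [laxExpr_smul]
        exact (Sob (-1 / 2) 0).smul_mem c hf.2 }
  toFun :=
    { toFun := fun f => ⟨⟨laxExpr u.1 f.1.1.1, f.2.2⟩,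
        fun n hn => laxExpr_neg_freq hn (f.1.2 n hn)⟩
      map_add' := fun f g => Subtype.ext (Subtype.ext
        (laxExpr_add (mem_of_mem_log u.2) f.2.1 g.2.1))
      map_smul' := fun c f => Subtype.ext (Subtype.ext (laxExpr_smul c u.1 f.1.1.1)) }

/-! ### Spectral notions for an unbounded operator -/

section Spectral

variable {E : Type*} [NormedAddCommGroup E] [NormedSpace ℂ E]

/-- `R` is the bounded inverse `(A - z)⁻¹ : E → Dom(A) ⊆ E`. -/
def IsResolventAt (A : E →ₗ.[ℂ] E) (z : ℂ) (R : E →L[ℂ] E) : Prop :=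
  (∀ x : E, ∃ h : R x ∈ A.domain, A ⟨R x, h⟩ - z • R x = x) ∧
    ∀ y : A.domain, R (A y - z • (y : E)) = y

/-- The resolvent set of `A`. -/
def resolventSet (A : E →ₗ.[ℂ] E) : Set ℂ := {z | ∃ R : E →L[ℂ] E, IsResolventAt A z R}

/-- The spectrum of `A`. -/
def spectrumSet (A : E →ₗ.[ℂ] E) : Set ℂ := (resolventSet A)ᶜ

/-- The resolvent set is non-empty and all resolvents are compact operators. -/
def HasCompactResolvent (A : E →ₗ.[ℂ] E) : Prop :=
  (resolventSet A).Nonempty ∧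
    ∀ (z : ℂ) (R : E →L[ℂ] E), IsResolventAt A z R → IsCompactOperator R

/-- `Ker (A - z)^k`, the elements of `Dom(A^k)` that are annihilated by `(A - z)^k`. -/
def kerPow (A : E →ₗ.[ℂ] E) (z : ℂ) : ℕ → Submodule ℂ E
  | 0 => ⊥
  | k + 1 => ((kerPow A z k).comap (A.toFun - z • A.domain.subtype)).map A.domain.subtype

/-- The generalized eigenspace `⋃ k, Ker (A - z)^k`. -/
def genEigenspace (A : E →ₗ.[ℂ] E) (z : ℂ) : Submodule ℂ E := ⨆ k : ℕ, kerPow A z k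

/-- The spectrum is a closed discrete subset of `ℂ` (finite in every disc) and consists of
eigenvalues of finite algebraic multiplicity. -/
def HasDiscreteSpectrum (A : E →ₗ.[ℂ] E) : Prop :=
  (∀ r : ℝ, (spectrumSet A ∩ Metric.closedBall 0 r).Finite) ∧
    ∀ z ∈ spectrumSet A, (∃ f : A.domain, f ≠ 0 ∧ A f = z • (f : E)) ∧
      FiniteDimensional ℂ (genEigenspace A z)

end Spectral

/-! ### The constants, the ball and the half-plane -/

/-- `K` is a constant of the multiplication estimate: for `u ∈ H^{-1/2,√log}_c` and
`v ∈ H^{1/2}_c` one has `uv ∈ H^{-1/2}_c` and `‖uv‖_{-1/2} ≤ K ‖u‖_{-1/2,√log} ‖v‖_{1/2}`. -/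
def IsProductConstant (K : ℝ) : Prop :=
  ∀ (u : Sob (-1 / 2) 1) (v : Sob (1 / 2) 0),
    ∃ h : mul u.1 v.1 ∈ Sob (-1 / 2) 0,
      ‖(⟨mul u.1 v.1, h⟩ : Sob (-1 / 2) 0)‖ ≤ K * ‖u‖ * ‖v‖

/-- The set of `u ∈ H^{-1/2,√log}_c` with `‖u - u₀‖_{-1/2,√log} < 1 / (4 K₀)`. -/
def logBall (K₀ : ℝ) (u₀ : Sob 0 0) : Set (Sob (-1 / 2) 1) :=
  {u | ‖u - inclL2 u₀‖ < 1 / (4 * K₀)}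

/-- The half-plane `Re λ < -(1 + C₀ ‖u₀‖ (1 + ‖u₀‖))`, with the `L²`-norm of `u₀`. -/
def halfPlane (C₀ : ℝ) (u₀ : Sob 0 0) : Set ℂ :=
  {z | z.re < -(1 + C₀ * ‖u₀‖ * (1 + ‖u₀‖))}

end LaxBO

end

/-! Write `L_u - λ = (D - λ) - T_u` as a map from `H^{1/2}_+` to `H^{-1/2}_+` and invert it by a
Neumann series in norms adapted to `λ`. Put `t = -Re λ ≥ 1` and replace the weights `⟨n⟩^{±1}` by
`(|n| + t)^{±1}`. For `n ≥ 0` one has `|n| + t ≤ |n - λ|`, so `(D - λ)⁻¹` is a contraction from the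
space with weight `(|n| + t)⁻¹` to the one with weight `|n| + t`. Multiplication by `u₀ ∈ L²` leads
back with squared norm at most `8 ‖u₀‖² / t`, which is small for large `t`. The remainder `u - u₀`
is only in `H^{-1/2,√log}`, but the shifted norms compare with those of `H^{±1/2}` with constant
one, in the favourable direction. Hence (1) bounds its contribution by `K₀ ‖u - u₀‖ ≤ 1/4`,
uniformly in `t`. This is why `C₀` does not depend on `K₀` (`exists_inverse_laxSub`).

Both product bounds are instances of one weighted convolution inequality (`tsum_conv_sq_le`), under
the Schur condition `∑ k, 1 / (q(k) r(m + k)) ≤ M p(m)`. For `q = r = ⟨n⟩` the sum is at most a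
multiple of `log(⟨m⟩ + 1) / ⟨m⟩`, which is the weight of `H^{-1/2,√log}`; for `q = r = |n| + t` it
is at most `8 / t`, uniformly in `m`.

Since `L²` is dense, every `u` lies in a ball of the required kind, so `L_u` has a resolvent point.
The resolvent there factors through the compact inclusion `H^{1/2}_+ ⊆ H^{-1/2}_+`, and one compact
resolvent yields closedness, compactness of all resolvents and, by Riesz theory, discreteness of the
spectrum. Finally `L_u - λ` is affine in `(u, λ)` and inversion is analytic on invertible operators.
-/

noncomputable section

namespace LaxBO

open scoped ENNReal

/-! ### Riesz theory of compact operators -/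

section CompactOperator

variable {E : Type*} [NormedAddCommGroup E] [NormedSpace ℂ E]

open Filter Topology in
/-- A compact operator admits no infinite strictly increasing chain of closed subspaces along which
it is triangular with diagonal entries bounded away from zero. -/
theorem not_exists_triangular_chain {K : E →L[ℂ] E} (hK : IsCompactOperator K)
    {V : ℕ → Submodule ℂ E} (hV : StrictMono V) (hc : ∀ n, IsClosed (V n : Set E))
    {μ : ℕ → ℂ} {δ : ℝ} (hδ : 0 < δ) (hμ : ∀ n, δ ≤ ‖μ n‖)
    (hKV : ∀ n, ∀ x ∈ V (n + 1), K x - μ n • x ∈ V n) : False := by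
  obtain ⟨c, hc1⟩ := NormedField.exists_one_lt_norm ℂ
  -- Riesz's lemma yields a bounded sequence of vectors in `V (n + 1)` at distance at least `1` from
  -- `V n`.
  have key (n : ℕ) : ∃ x ∈ V (n + 1), ‖x‖ ≤ ‖c‖ + 1 ∧ ∀ y ∈ V n, 1 ≤ ‖x - y‖ := by
    have h₁ : IsClosed ((V n).comap (V (n + 1)).subtype : Set (V (n + 1))) := by
      simpa using! (hc n).preimage_val
    have h₂ : ∃ x : V (n + 1), x ∉ (V n).comap (V (n + 1)).subtype := by
      obtain ⟨x, hx, hx'⟩ := SetLike.exists_of_lt (hV n.lt_succ_self)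
      exact ⟨⟨x, hx⟩, by simpa using hx'⟩
    obtain ⟨⟨x, hx⟩, hxn, hxy⟩ := riesz_lemma_of_norm_lt hc1 (R := ‖c‖ + 1) (by simp) h₁ h₂
    simp only [Submodule.mem_comap, Submodule.subtype_apply, Subtype.forall] at hxn hxy
    exact ⟨x, hx, hxn, fun y hy => hxy y (hV.monotone n.le_succ hy) hy⟩
  choose f hfV hfn hfy using key
  have hp {m n : ℕ} (hmn : m < n) : δ ≤ ‖K (f n) - K (f m)‖ := by
    have hμ0 : μ n ≠ 0 := fun h => by simpa [h] using hδ.trans_le (hμ n)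
    have h1 : K (f m) ∈ V n := by
      have h2 := (V (m + 1)).add_mem (hV.monotone m.le_succ (hKV m _ (hfV m)))
        ((V (m + 1)).smul_mem (μ m) (hfV m))
      rw [sub_add_cancel] at h2
      exact hV.monotone hmn h2
    have h3 : (μ n)⁻¹ • (K (f m) - (K (f n) - μ n • f n)) ∈ V n :=
      (V n).smul_mem _ ((V n).sub_mem h1 (hKV n _ (hfV n)))
    -- The difference is `μ n` times `f n` minus an element of `V n`, so the images stay `δ` apart
    -- and no subsequence is Cauchy.
    have h4 : K (f n) - K (f m)
        = μ n • (f n - (μ n)⁻¹ • (K (f m) - (K (f n) - μ n • f n))) := by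
      rw [smul_sub, smul_inv_smul₀ hμ0]
      abel
    rw [h4, norm_smul]
    have := mul_le_mul (hμ n) (hfy n _ h3) zero_le_one (norm_nonneg _)
    simpa using this
  obtain ⟨S, hS, hS'⟩ := hK.image_closedBall_subset_compact (f := (K : E →ₗ[ℂ] E)) (‖c‖ + 1)
  obtain ⟨y, -, ψ, hψ, hψy⟩ := hS.tendsto_subseq
    (x := fun n => K (f n)) (fun n => hS' ⟨f n, by simp [hfn], rfl⟩)
  have hcs := hψy.cauchySeq
  rw [Metric.cauchySeq_iff'] at hcs
  obtain ⟨N, hN⟩ := hcs δ hδ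
  have h1 : ‖K (f (ψ (N + 1))) - K (f (ψ N))‖ < δ := by
    simpa [dist_eq_norm_sub] using hN (N + 1)
  exact h1.not_ge (hp (hψ N.lt_succ_self))

/-- The eigenvalues of a compact operator outside a disc around zero are finite in number. -/
theorem finite_hasEigenvalue {K : E →L[ℂ] E} (hK : IsCompactOperator K) {δ : ℝ} (hδ : 0 < δ) :
    {μ : ℂ | δ ≤ ‖μ‖ ∧ Module.End.HasEigenvalue (K : Module.End ℂ E) μ}.Finite := by
  by_contra hinf
  have hinf : {μ : ℂ | δ ≤ ‖μ‖ ∧ Module.End.HasEigenvalue (K : Module.End ℂ E) μ}.Infinite := hinf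
  let μ : ℕ ↪ _ := hinf.natEmbedding
  choose x hx using fun n => (μ n).2.2.exists_hasEigenvector
  have hli : LinearIndependent ℂ x :=
    Module.End.eigenvectors_linearIndependent' (K : Module.End ℂ E) (fun n => (μ n : ℂ))
      (Subtype.val_injective.comp μ.injective) x hx
  -- On spans of eigenvectors for distinct eigenvalues `K` is triangular: `K - μ n` kills `x n` and
  -- rescales the earlier eigenvectors.
  let V : ℕ → Submodule ℂ E := fun n => Submodule.span ℂ (x '' Set.Iio n)
  have hfin (n : ℕ) : FiniteDimensional ℂ (V n) :=
    FiniteDimensional.span_of_finite ℂ ((Set.finite_Iio n).image x)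
  have hmem (n : ℕ) : x n ∈ V (n + 1) := Submodule.subset_span ⟨n, n.lt_succ_self, rfl⟩
  have hmono : Monotone V := fun m n hmn =>
    Submodule.span_mono (Set.image_mono (Set.Iio_subset_Iio hmn))
  have hnot (n : ℕ) : x n ∉ V n := hli.notMem_span_image (by simp)
  refine not_exists_triangular_chain hK (V := V) (strictMono_nat_of_lt_succ fun n => ?_)
    (fun n => (V n).closed_of_finiteDimensional) hδ (μ := fun n => (μ n : ℂ)) (fun n => (μ n).2.1) ?_
  · exact lt_of_le_of_ne (hmono n.le_succ) fun h => hnot n (h ▸ hmem n)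
  · intro n y hy
    let S : E →ₗ[ℂ] E := (K : E →ₗ[ℂ] E) - (μ n : ℂ) • LinearMap.id
    suffices h : V (n + 1) ≤ (V n).comap S from h hy
    refine Submodule.span_le.2 ?_
    rintro _ ⟨i, hi, rfl⟩
    have h1 : S (x i) = ((μ i : ℂ) - μ n) • x i := by
      have := (hx i).apply_eq_smul
      simp only [S, LinearMap.sub_apply, LinearMap.smul_apply, LinearMap.id_apply, sub_smul]
      rw [← this]
    change S (x i) ∈ V n
    rw [h1]
    rcases Nat.lt_succ_iff_lt_or_eq.1 hi with h | rfl
    · exact (V n).smul_mem _ (hmono h (hmem i))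
    · rw [sub_self, zero_smul]
      exact (V i).zero_mem

/-- The kernels of the powers of `K - μ`, for a compact operator `K` and `μ ≠ 0`, are of finite
dimension. -/
theorem finiteDimensional_ker_pow {K : E →L[ℂ] E} (hK : IsCompactOperator K) {μ : ℂ} (hμ : μ ≠ 0)
    (k : ℕ) : FiniteDimensional ℂ (((K : Module.End ℂ E) - μ • 1) ^ k).ker := by
  -- On the eigenspace `μ⁻¹ K` is the identity, which is therefore compact.
  have h1 : FiniteDimensional ℂ ((K : Module.End ℂ E) - μ • 1).ker := by
    set G := ((K : Module.End ℂ E) - μ • 1).ker with hG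
    have hGK (x : E) (hx : x ∈ G) : K x = μ • x := by
      have : K x - μ • x = 0 := hx
      exact sub_eq_zero.1 this
    have hcl : IsClosed (G : Set E) := (K - μ • 1).isClosed_ker
    have hmap : ∀ x ∈ G, (μ⁻¹ • (K : E →ₗ[ℂ] E)) x ∈ G := fun x hx => by
      change μ⁻¹ • K x ∈ G
      rw [hGK x hx, inv_smul_smul₀ hμ]
      exact hx
    have hc : IsCompactOperator (μ⁻¹ • (K : E →ₗ[ℂ] E)) := hK.smul μ⁻¹
    have := hc.restrict hmap hcl
    refine FiniteDimensional.of_isCompactOperator_id (𝕜 := ℂ) ?_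
    have hid : ((μ⁻¹ • (K : E →ₗ[ℂ] E)).restrict hmap : G → G) = id := by
      funext x
      apply Subtype.ext
      change μ⁻¹ • K x = x
      rw [hGK x x.2, inv_smul_smul₀ hμ]
    rwa [hid] at this
  induction k with
  | zero =>
    rw [pow_zero, Module.End.one_eq_id, LinearMap.ker_id]
    infer_instance
  | succ k ih =>
    rw [← Submodule.fg_iff_finiteDimensional] at *
    -- `K - μ` maps the kernel of its power `k + 1` into that of its power `k`, and the part it
    -- annihilates lies in the eigenspace.
    refine Submodule.fg_of_fg_map_of_fg_inf_ker ((K : Module.End ℂ E) - μ • 1) ?_ ?_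
    · rw [Submodule.fg_iff_finiteDimensional] at *
      refine Submodule.finiteDimensional_of_le
        (S₂ := (((K : Module.End ℂ E) - μ • 1) ^ k).ker) ?_
      rintro _ ⟨x, hx, rfl⟩
      rw [SetLike.mem_coe, LinearMap.mem_ker, pow_succ] at hx
      exact hx
    · rw [Submodule.fg_iff_finiteDimensional] at *
      exact Submodule.finiteDimensional_of_le (inf_le_right)

/-- If the kernels grew strictly forever, they would form a triangular chain with constant diagonal
entry `μ`. So they stabilise at a finite power. -/
theorem finiteDimensional_iSup_ker_pow {K : E →L[ℂ] E} (hK : IsCompactOperator K) {μ : ℂ}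
    (hμ : μ ≠ 0) :
    FiniteDimensional ℂ (⨆ k : ℕ, (((K : Module.End ℂ E) - μ • 1) ^ k).ker : Submodule ℂ E) := by
  set S : Module.End ℂ E := (K : Module.End ℂ E) - μ • 1 with hS
  have hmono : Monotone fun k : ℕ => (S ^ k).ker := monotone_nat_of_le_succ fun k x hx => by
    rw [LinearMap.mem_ker] at *
    rw [pow_succ', Module.End.mul_apply, hx, map_zero]
  obtain ⟨k, hk⟩ : ∃ k : ℕ, (S ^ (k + 1)).ker ≤ (S ^ k).ker := by
    by_contra! h
    have := finiteDimensional_ker_pow hK hμ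
    refine not_exists_triangular_chain hK (V := fun k => (S ^ k).ker)
      (strictMono_nat_of_lt_succ fun n => lt_of_le_not_ge (hmono n.le_succ) (h n))
      (fun n => ((S ^ n).ker).closed_of_finiteDimensional) (μ := fun _ => μ)
      (norm_pos_iff.2 hμ) (fun _ => le_rfl) fun n x hx => ?_
    rw [LinearMap.mem_ker, pow_succ] at hx
    exact hx
  have hle (j : ℕ) : (S ^ (k + j)).ker ≤ (S ^ k).ker := by
    induction j with
    | zero => exact le_rfl
    | succ j ih =>
      intro x hx
      refine hk ?_
      rw [LinearMap.mem_ker, ← add_assoc, pow_succ, Module.End.mul_apply] at hx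
      have := ih hx
      rwa [LinearMap.mem_ker, ← Module.End.mul_apply, ← pow_succ] at this
  have := finiteDimensional_ker_pow hK hμ k
  refine Submodule.finiteDimensional_of_le (S₂ := (S ^ k).ker) (iSup_le fun j => ?_)
  exact (hmono (Nat.le_add_left j k)).trans (hle j)

end CompactOperator

/-! ### From one compact resolvent to a discrete spectrum -/

section Resolvent

variable {E : Type*} [NormedAddCommGroup E] [NormedSpace ℂ E] {A : E →ₗ.[ℂ] E} {z₀ : ℂ}
  {R : E →L[ℂ] E}

/-- A pair `(x, y)` is in the graph exactly when `R (y - z₀ x) = x`, a closed condition. -/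
theorem IsResolventAt.isClosed (h : IsResolventAt A z₀ R) : A.IsClosed := by
  have hg : (A.graph : Set (E × E)) = {p | R (p.2 - z₀ • p.1) = p.1} := by
    ext ⟨x, y⟩
    rw [SetLike.mem_coe, LinearPMap.mem_graph_iff]
    constructor
    · rintro ⟨a, rfl, rfl⟩
      exact h.2 a
    · intro hxy
      have hxy : R (y - z₀ • x) = x := hxy
      obtain ⟨hd, he⟩ := h.1 (y - z₀ • x)
      refine ⟨⟨_, hd⟩, hxy, ?_⟩
      have := sub_eq_iff_eq_add.1 he
      rw [this]
      change y - z₀ • x + z₀ • R (y - z₀ • x) = y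
      rw [hxy, sub_add_cancel]
  rw [LinearPMap.IsClosed, hg]
  exact isClosed_eq (by fun_prop) (by fun_prop)

/-- The resolvent identity in the form `R' = R (1 + (z - z₀) R')`. -/
theorem IsResolventAt.eq_comp {z : ℂ} {R' : E →L[ℂ] E} (h : IsResolventAt A z₀ R)
    (h' : IsResolventAt A z R') : R' = R ∘L (1 + (z - z₀) • R') := by
  ext x
  obtain ⟨hd, he⟩ := h'.1 x
  have h1 := h.2 ⟨_, hd⟩
  rw [sub_eq_iff_eq_add.1 he] at h1
  change R' x = R (x + (z - z₀) • R' x)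
  rw [sub_smul, ← add_sub_assoc]
  exact h1.symm

theorem IsResolventAt.hasCompactResolvent (h : IsResolventAt A z₀ R) (hR : IsCompactOperator R) :
    HasCompactResolvent A := by
  refine ⟨⟨z₀, R, h⟩, fun z R' h' => ?_⟩
  rw [h.eq_comp h']
  exact hR.comp_clm (1 + (z - z₀) • R')

theorem IsResolventAt.ne_of_mem_spectrumSet (h : IsResolventAt A z₀ R) {z : ℂ}
    (hz : z ∈ spectrumSet A) : z - z₀ ≠ 0 := fun h0 => hz (by
  rw [sub_eq_zero.1 h0]
  exact ⟨R, h⟩)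

/-- On the domain `A - z = (1 - (z - z₀) R)(A - z₀)`, so an inverse `V` of the first factor gives
the resolvent `R V`; both identities need that `V` commutes with `R`. -/
theorem IsResolventAt.mul_inverse (h : IsResolventAt A z₀ R) {z : ℂ} {V : E →L[ℂ] E}
    (h1 : (1 - (z - z₀) • R) * V = 1) (h2 : V * (1 - (z - z₀) • R) = 1) :
    IsResolventAt A z (R * V) := by
  have hr : R * V = V * R := by
    have hc : (1 - (z - z₀) • R) * R = R * (1 - (z - z₀) • R) := by
      rw [sub_mul, mul_sub, one_mul, mul_one, smul_mul_assoc, mul_smul_comm]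
    calc R * V = (V * (1 - (z - z₀) • R)) * (R * V) := by rw [h2, one_mul]
      _ = V * ((1 - (z - z₀) • R) * R) * V := by simp only [mul_assoc]
      _ = V * R * ((1 - (z - z₀) • R) * V) := by rw [hc]; simp only [mul_assoc]
      _ = V * R := by rw [h1, mul_one]
  constructor
  · intro x
    obtain ⟨hd, he⟩ := h.1 (V x)
    refine ⟨hd, ?_⟩
    have h3 : V x - (z - z₀) • R (V x) = x := congrArg (fun T : E →L[ℂ] E => T x) h1
    change A ⟨R (V x), hd⟩ - z • R (V x) = x
    rw [sub_eq_iff_eq_add.1 he]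
    rw [sub_smul] at h3
    refine Eq.trans ?_ h3
    abel
  · intro y
    rw [hr]
    change V (R (A y - z • (y : E))) = y
    have h4 : A y - z • (y : E) = (A y - z₀ • (y : E)) - (z - z₀) • (y : E) := by
      rw [sub_smul]
      abel
    rw [h4, map_sub, h.2 y, map_smul]
    exact congrArg (fun T : E →L[ℂ] E => T y) h2

/-- Fredholm alternative: if `(z - z₀)⁻¹` were not an eigenvalue of the compact `R`, then `1 - (z -
z₀) R` would be invertible and `z` would be in the resolvent set. -/
theorem IsResolventAt.hasEigenvalue [CompleteSpace E] (h : IsResolventAt A z₀ R)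
    (hR : IsCompactOperator R) {z : ℂ} (hz : z ∈ spectrumSet A) :
    Module.End.HasEigenvalue (R : Module.End ℂ E) (z - z₀)⁻¹ := by
  have h0 := h.ne_of_mem_spectrumSet hz
  refine (IsCompactOperator.hasEigenvalue_or_mem_resolventSet hR (inv_ne_zero h0)).resolve_right
    fun hres => hz ?_
  rw [spectrum.mem_resolventSet_iff] at hres
  have h1 : (1 - (z - z₀) • R) = (z - z₀) • (algebraMap ℂ (E →L[ℂ] E) (z - z₀)⁻¹ - R) := by
    rw [smul_sub, Algebra.algebraMap_eq_smul_one, smul_inv_smul₀ h0]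
  have hu : IsUnit (1 - (z - z₀) • R) := by
    rw [h1]
    exact hres.smul (Units.mk0 _ h0)
  obtain ⟨U, hU⟩ := hu
  refine ⟨R * (↑U⁻¹ : E →L[ℂ] E), h.mul_inverse ?_ ?_⟩
  · rw [← hU, Units.mul_inv]
  · rw [← hU, Units.inv_mul]

/-- On the domain `R (A - z) = -(z - z₀) (R - (z - z₀)⁻¹)`, and `R` commutes with the powers of the
last factor. Thus each step of `kerPow` costs one such factor. -/
theorem IsResolventAt.kerPow_le (h : IsResolventAt A z₀ R) {z : ℂ} (hz : z - z₀ ≠ 0) (k : ℕ) :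
    kerPow A z k ≤ (((R : Module.End ℂ E) - (z - z₀)⁻¹ • 1) ^ k).ker := by
  induction k with
  | zero => exact bot_le
  | succ k ih =>
    rintro _ ⟨y, hy, rfl⟩
    set S := (R : Module.End ℂ E) - (z - z₀)⁻¹ • 1 with hS
    have h1 : (S ^ k) (A y - z • (y : E)) = 0 := ih hy
    have hc : Commute (R : Module.End ℂ E) (S ^ k) :=
      ((Commute.refl _).sub_right ((Commute.one_right _).smul_right _)).pow_right k
    have h2 : (S ^ k) (R (A y - z • (y : E))) = 0 := by
      have := congrArg (fun T : Module.End ℂ E => T (A y - z • (y : E))) hc.eq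
      change R ((S ^ k) (A y - z • (y : E))) = (S ^ k) (R (A y - z • (y : E))) at this
      rw [← this, h1, map_zero]
    have h4 : A y - z • (y : E) = (A y - z₀ • (y : E)) - (z - z₀) • (y : E) := by
      rw [sub_smul]
      abel
    have h5 : R (A y - z • (y : E)) = (-(z - z₀)) • S y := by
      rw [h4, map_sub, h.2 y, map_smul]
      change _ = (-(z - z₀)) • (R y - (z - z₀)⁻¹ • (y : E))
      rw [smul_sub, neg_smul, neg_smul, smul_inv_smul₀ hz]
      abel
    rw [h5, map_smul, smul_eq_zero_iff_right (neg_ne_zero.2 hz)] at h2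
    rw [LinearMap.mem_ker, pow_succ]
    exact h2

theorem IsResolventAt.hasDiscreteSpectrum [CompleteSpace E] (h : IsResolventAt A z₀ R)
    (hR : IsCompactOperator R) : HasDiscreteSpectrum A := by
  refine ⟨fun r => ?_, fun z hz => ⟨?_, ?_⟩⟩
  · have hpos : 0 < |r| + ‖z₀‖ + 1 := by positivity
    have hfin := (finite_hasEigenvalue hR (inv_pos.2 hpos)).image fun μ : ℂ => μ⁻¹ + z₀
    refine hfin.subset ?_
    rintro z ⟨hz, hzr⟩
    have h0 := h.ne_of_mem_spectrumSet hz
    refine ⟨(z - z₀)⁻¹, ⟨?_, h.hasEigenvalue hR hz⟩, by simp⟩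
    rw [norm_inv]
    refine inv_anti₀ (norm_pos_iff.2 h0) ?_
    have h1 : ‖z‖ ≤ r := by simpa using hzr
    have h2 := norm_sub_le z z₀
    have h3 := le_abs_self r
    linarith
  · have h0 := h.ne_of_mem_spectrumSet hz
    obtain ⟨f, hf⟩ := (h.hasEigenvalue hR hz).exists_hasEigenvector
    have hRf : R f = (z - z₀)⁻¹ • f := hf.apply_eq_smul
    obtain ⟨hd, he⟩ := h.1 f
    refine ⟨⟨R f, hd⟩, fun hh => hf.2 ?_, ?_⟩
    · have hh : R f = 0 := congrArg Subtype.val hh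
      rw [hh] at hRf
      exact (smul_eq_zero_iff_right (inv_ne_zero h0)).1 hRf.symm
    · rw [sub_eq_iff_eq_add.1 he]
      change f + z₀ • R f = z • R f
      have h3 : f = (z - z₀) • R f := by rw [hRf, smul_inv_smul₀ h0]
      nth_rw 1 [h3]
      rw [← add_smul, sub_add_cancel]
  · have h0 := h.ne_of_mem_spectrumSet hz
    have := finiteDimensional_iSup_ker_pow hR (inv_ne_zero h0)
    exact Submodule.finiteDimensional_of_le
      (S₂ := ⨆ k : ℕ, (((R : Module.End ℂ E) - (z - z₀)⁻¹ • 1) ^ k).ker)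
      (iSup_mono fun k => h.kerPow_le h0 k)

end Resolvent

/-! ### Weighted convolution inequality -/

section Convolution

theorem ennreal_tsum_mul_sq_le {ι : Type*} (f g : ι → ℝ≥0∞) :
    (∑' i, f i * g i) ^ 2 ≤ (∑' i, f i ^ 2) * ∑' i, g i ^ 2 := by
  let : MeasurableSpace ι := ⊤
  have h := ENNReal.lintegral_mul_le_Lp_mul_Lq (MeasureTheory.Measure.count : MeasureTheory.Measure ι)
    (p := 2) (q := 2) Real.HolderConjugate.two_two (f := f) (g := g)
    (Measurable.of_discrete).aemeasurable (Measurable.of_discrete).aemeasurable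
  simp only [MeasureTheory.lintegral_count, Pi.mul_apply, ENNReal.rpow_two] at h
  calc (∑' i, f i * g i) ^ 2
      ≤ ((∑' i, f i ^ 2) ^ (1 / 2 : ℝ) * (∑' i, g i ^ 2) ^ (1 / 2 : ℝ)) ^ 2 := by gcongr
    _ = _ := by
      rw [mul_pow, ← ENNReal.rpow_two, ← ENNReal.rpow_two, ← ENNReal.rpow_mul, ← ENNReal.rpow_mul]
      norm_num

/-- The Cauchy-Schwarz inequality with a weight. -/
theorem ennreal_tsum_mul_sq_le_weighted {ι : Type*} (f g s : ι → ℝ≥0∞) (h0 : ∀ i, s i ≠ 0)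
    (ht : ∀ i, s i ≠ ⊤) :
    (∑' i, f i * g i) ^ 2 ≤ (∑' i, (s i)⁻¹ * f i ^ 2) * ∑' i, s i * g i ^ 2 := by
  have hs (i : ι) : (s i) ^ (1 / 2 : ℝ) ≠ 0 := by
    simp [ENNReal.rpow_eq_zero_iff, h0 i, ht i]
  have hs' (i : ι) : (s i) ^ (1 / 2 : ℝ) ≠ ⊤ := by
    simp [ENNReal.rpow_eq_top_iff, h0 i, ht i]
  have hsq (i : ι) : ((s i) ^ (1 / 2 : ℝ)) ^ 2 = s i := by
    rw [← ENNReal.rpow_two, ← ENNReal.rpow_mul]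
    norm_num
  have h := ennreal_tsum_mul_sq_le (fun i => ((s i) ^ (1 / 2 : ℝ))⁻¹ * f i)
    (fun i => (s i) ^ (1 / 2 : ℝ) * g i)
  simp only [mul_pow, ← ENNReal.inv_pow, hsq] at h
  refine le_trans (le_of_eq ?_) h
  congr 2
  funext i
  rw [mul_mul_mul_comm, ENNReal.inv_mul_cancel (hs i) (hs' i), one_mul]

variable {a b p q r : ℤ → ℝ≥0∞} {M : ℝ≥0∞}

/-- Duality form. After `n = m + k` the pairing is `∑ a(m) ∑ b(k) w(m + k)`. Cauchy-Schwarz in `k`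
with weight `q(k) r(m + k)` produces the Schur sum, hence a factor `M p(m)`; Cauchy-Schwarz in `m`
with weight `p` cancels it. -/
theorem tsum_conv_mul_sq_le
    (hp0 : ∀ n, p n ≠ 0) (hpt : ∀ n, p n ≠ ⊤) (hq0 : ∀ n, q n ≠ 0) (hqt : ∀ n, q n ≠ ⊤)
    (hr0 : ∀ n, r n ≠ 0) (hrt : ∀ n, r n ≠ ⊤)
    (hM : ∀ m, ∑' k, (q k)⁻¹ * (r (m + k))⁻¹ ≤ M * p m) (w : ℤ → ℝ≥0∞) :
    (∑' n, (∑' k, a (n - k) * b k) * w n) ^ 2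
      ≤ M * (∑' m, p m * a m ^ 2) * (∑' k, q k * b k ^ 2) * ∑' n, r n * w n ^ 2 := by
  have e1 : ∑' n, (∑' k, a (n - k) * b k) * w n = ∑' m, a m * ∑' k, b k * w (m + k) := by
    simp_rw [← ENNReal.tsum_mul_right, ← ENNReal.tsum_mul_left]
    rw [ENNReal.tsum_comm]
    conv_rhs => rw [ENNReal.tsum_comm]
    refine tsum_congr fun k => ?_
    rw [← (Equiv.addRight k).tsum_eq]
    refine tsum_congr fun m => ?_
    simp [mul_assoc]
  have e2 (m : ℤ) : (∑' k, b k * w (m + k)) ^ 2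
      ≤ M * p m * ∑' k, (q k * b k ^ 2) * (r (m + k) * w (m + k) ^ 2) := by
    have h := ennreal_tsum_mul_sq_le_weighted (fun _ : ℤ => (1 : ℝ≥0∞))
      (fun k => b k * w (m + k)) (fun k => q k * r (m + k))
      (fun k => mul_ne_zero (hq0 _) (hr0 _)) (fun k => ENNReal.mul_ne_top (hqt _) (hrt _))
    simp only [one_mul, one_pow, mul_one] at h
    refine h.trans (mul_le_mul' ((le_of_eq ?_).trans (hM m)) (le_of_eq ?_))
    · refine tsum_congr fun k => ENNReal.mul_inv (Or.inl (hq0 _)) (Or.inl (hqt _))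
    · refine tsum_congr fun k => ?_
      ring
  have e3 : ∑' m, ∑' k, (q k * b k ^ 2) * (r (m + k) * w (m + k) ^ 2)
      = (∑' k, q k * b k ^ 2) * ∑' n, r n * w n ^ 2 := by
    rw [ENNReal.tsum_comm, ← ENNReal.tsum_mul_right]
    refine tsum_congr fun k => ?_
    rw [ENNReal.tsum_mul_left, ← (Equiv.addRight k).tsum_eq (fun n => r n * w n ^ 2)]
    rfl
  have h := ennreal_tsum_mul_sq_le_weighted (fun m => ∑' k, b k * w (m + k)) a p hp0 hpt
  rw [e1]
  simp_rw [mul_comm (a _)]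
  refine h.trans ?_
  have e4 : ∑' m, (p m)⁻¹ * (∑' k, b k * w (m + k)) ^ 2
      ≤ M * ((∑' k, q k * b k ^ 2) * ∑' n, r n * w n ^ 2) := by
    rw [← e3, ← ENNReal.tsum_mul_left]
    refine ENNReal.tsum_le_tsum fun m => ?_
    calc (p m)⁻¹ * (∑' k, b k * w (m + k)) ^ 2
        ≤ (p m)⁻¹ * (M * p m * ∑' k, (q k * b k ^ 2) * (r (m + k) * w (m + k) ^ 2)) := by
          gcongr
          exact e2 m
      _ = ((p m)⁻¹ * p m) * (M * ∑' k, (q k * b k ^ 2) * (r (m + k) * w (m + k) ^ 2)) := by ring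
      _ = _ := by rw [ENNReal.inv_mul_cancel (hp0 m) (hpt m), one_mul]
  calc _ ≤ M * ((∑' k, q k * b k ^ 2) * ∑' n, r n * w n ^ 2) * ∑' m, p m * a m ^ 2 := by gcongr
    _ = _ := by ring

/-- The weighted `ℓ²` bound for convolutions, under a Schur type condition on the weights. -/
theorem tsum_conv_sq_le
    (hp0 : ∀ n, p n ≠ 0) (hpt : ∀ n, p n ≠ ⊤) (hq0 : ∀ n, q n ≠ 0) (hqt : ∀ n, q n ≠ ⊤)
    (hr0 : ∀ n, r n ≠ 0) (hrt : ∀ n, r n ≠ ⊤)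
    (hM : ∀ m, ∑' k, (q k)⁻¹ * (r (m + k))⁻¹ ≤ M * p m) (hMt : M ≠ ⊤)
    (ha : ∑' m, p m * a m ^ 2 ≠ ⊤) (hb : ∑' k, q k * b k ^ 2 ≠ ⊤) :
    ∑' n, (r n)⁻¹ * (∑' k, a (n - k) * b k) ^ 2
      ≤ M * (∑' m, p m * a m ^ 2) * (∑' k, q k * b k ^ 2) := by
  classical
  set c : ℤ → ℝ≥0∞ := fun n => ∑' k, a (n - k) * b k with hc
  set C := M * (∑' m, p m * a m ^ 2) * (∑' k, q k * b k ^ 2) with hC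
  have hCt : C ≠ ⊤ := ENNReal.mul_ne_top (ENNReal.mul_ne_top hMt ha) hb
  have key (w : ℤ → ℝ≥0∞) : (∑' n, c n * w n) ^ 2 ≤ C * ∑' n, r n * w n ^ 2 :=
    tsum_conv_mul_sq_le hp0 hpt hq0 hqt hr0 hrt hM w
  -- Test with a unit mass; finiteness is what permits the cancellation of `F` at the end.
  have hct (n : ℤ) : c n ≠ ⊤ := by
    have h := key (Pi.single n 1)
    rw [tsum_eq_single n (fun k hk => by simp [hk]), tsum_eq_single n (fun k hk => by simp [hk])] at h
    simp only [Pi.single_eq_same, mul_one, one_pow] at h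
    intro htop
    rw [htop] at h
    have := ENNReal.mul_ne_top hCt (hrt n)
    simp at h
    exact this h
  rw [ENNReal.tsum_eq_iSup_sum]
  refine iSup_le fun S => ?_
  set F := ∑ n ∈ S, (r n)⁻¹ * c n ^ 2 with hF
  have hFt : F ≠ ⊤ := (ENNReal.sum_lt_top.2 fun n _ => (ENNReal.mul_ne_top
    (ENNReal.inv_ne_top.2 (hr0 n)) (ENNReal.pow_ne_top (hct n))).lt_top).ne
  -- The extremal test sequence, cut off to `S`: both sums become `F`, and the bound reads `F ^ 2 ≤
  -- C * F`.
  have h := key fun n => if n ∈ S then (r n)⁻¹ * c n else 0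
  rw [tsum_eq_sum (s := S) (fun n hn => by simp [hn]),
    tsum_eq_sum (s := S) (fun n hn => by simp [hn])] at h
  have h1 : ∑ n ∈ S, c n * (if n ∈ S then (r n)⁻¹ * c n else 0) = F :=
    Finset.sum_congr rfl fun n hn => by
      rw [if_pos hn]
      ring
  have h2 : ∑ n ∈ S, r n * (if n ∈ S then (r n)⁻¹ * c n else 0) ^ 2 = F :=
    Finset.sum_congr rfl fun n hn => by
      rw [if_pos hn]
      calc r n * ((r n)⁻¹ * c n) ^ 2 = (r n * (r n)⁻¹) * ((r n)⁻¹ * c n ^ 2) := by ring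
        _ = _ := by rw [ENNReal.mul_inv_cancel (hr0 n) (hrt n), one_mul]
  rw [h1, h2] at h
  rcases eq_or_ne F 0 with h0 | h0
  · rw [h0]
    exact zero_le
  · rw [sq] at h
    exact (ENNReal.mul_le_mul_iff_left h0 hFt).1 h

end Convolution

/-! ### The two Schur sums -/

section WeightSums

theorem tsum_int_natAbs_le (g : ℕ → ℝ≥0∞) : ∑' k : ℤ, g k.natAbs ≤ 2 * ∑' n, g n := by
  have h1 : HasSum (fun n : ℕ => g (n : ℤ).natAbs) (∑' n, g n) := ENNReal.summable.hasSum
  have e : (fun n : ℕ => g (-((n : ℤ) + 1)).natAbs) = fun n => g (n + 1) := by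
    funext n
    congr 1
  have h2 : HasSum (fun n : ℕ => g (-((n : ℤ) + 1)).natAbs) (∑' n, g (n + 1)) := by
    rw [e]
    exact ENNReal.summable.hasSum
  have h3 := HasSum.of_nat_of_neg_add_one (f := fun k : ℤ => g k.natAbs) h1 h2
  rw [h3.tsum_eq, two_mul]
  exact add_le_add le_rfl (ENNReal.tsum_comp_le_tsum_of_injective (add_left_injective 1) g)

/-- Telescoping: `1 / s² ≤ 2 / s - 2 / (s + 1)` for `s ≥ 1`. -/
theorem sum_inv_sq_le {t : ℝ} (ht : 1 ≤ t) (K : ℕ) :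
    ∑ n ∈ Finset.range K, ((n + t) ^ 2)⁻¹ ≤ 2 / t := by
  suffices h : ∑ n ∈ Finset.range K, ((n + t) ^ 2)⁻¹ ≤ 2 / t - 2 / (K + t) by
    have : 0 ≤ 2 / (K + t) := by positivity
    linarith
  induction K with
  | zero => simp
  | succ K ih =>
    rw [Finset.sum_range_succ]
    have h0 : 0 < (K : ℝ) + t := by positivity
    have h1 : (((K : ℝ) + t) ^ 2)⁻¹ ≤ 2 / (K + t) - 2 / (K + 1 + t) := by
      rw [div_sub_div _ _ h0.ne' (by positivity), inv_eq_one_div,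
        div_le_div_iff₀ (by positivity) (by positivity)]
      have : (0 : ℝ) ≤ K := K.cast_nonneg
      nlinarith
    push_cast
    linarith

theorem tsum_le_of_real_sum_le {g : ℕ → ℝ} (hg : ∀ n, 0 ≤ g n) {c : ℝ}
    (h : ∀ K, ∑ n ∈ Finset.range K, g n ≤ c) :
    ∑' n, ENNReal.ofReal (g n) ≤ ENNReal.ofReal c := by
  refine ENNReal.tsum_le_of_sum_range_le fun K => ?_
  rw [← ENNReal.ofReal_sum_of_nonneg fun n _ => hg n]
  exact ENNReal.ofReal_le_ofReal (h K)

/-- A Schur sum for products of two even functions is bounded by one sum over `ℕ`. -/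
theorem tsum_shift_le {x : ℤ → ℤ → ℝ≥0∞} {g : ℕ → ℝ≥0∞} {m : ℤ}
    (h : ∀ k, x k (m + k) ≤ g k.natAbs + g (m + k).natAbs) :
    ∑' k, x k (m + k) ≤ 4 * ∑' n, g n := by
  calc ∑' k, x k (m + k) ≤ ∑' k : ℤ, (g k.natAbs + g (m + k).natAbs) := ENNReal.tsum_le_tsum h
    _ = ∑' k : ℤ, g k.natAbs + ∑' k : ℤ, g k.natAbs := by
      rw [ENNReal.tsum_add]
      congr 1
      exact (Equiv.addLeft m).tsum_eq (fun k => g k.natAbs)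
    _ ≤ 2 * ∑' n, g n + 2 * ∑' n, g n := add_le_add (tsum_int_natAbs_le g) (tsum_int_natAbs_le g)
    _ = _ := by ring

theorem natAbs_cast_real (k : ℤ) : (k.natAbs : ℝ) = |(k : ℝ)| := by
  rw [Nat.cast_natAbs, Int.cast_abs]

/-- By `1 / (xy) ≤ 1 / x² + 1 / y²` the shift by `m` disappears, which makes the bound uniform in
`m`. -/
theorem tsum_shifted_inv_le {t : ℝ} (ht : 1 ≤ t) (m : ℤ) :
    ∑' k : ℤ, (ENNReal.ofReal (|(k : ℝ)| + t))⁻¹ * (ENNReal.ofReal (|((m + k : ℤ) : ℝ)| + t))⁻¹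
      ≤ ENNReal.ofReal (8 / t) := by
  have ht0 : 0 < t := by linarith
  refine (tsum_shift_le (g := fun n => ENNReal.ofReal (((n + t) ^ 2)⁻¹))
    (x := fun k l => (ENNReal.ofReal (|(k : ℝ)| + t))⁻¹ * (ENNReal.ofReal (|(l : ℝ)| + t))⁻¹)
    fun k => ?_).trans ?_
  · rw [natAbs_cast_real, natAbs_cast_real]
    set x := |(k : ℝ)| + t with hx
    set y := |((m + k : ℤ) : ℝ)| + t with hy
    have hx0 : 0 < x := by positivity
    have hy0 : 0 < y := by positivity
    rw [← ENNReal.ofReal_inv_of_pos hx0, ← ENNReal.ofReal_inv_of_pos hy0,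
      ← ENNReal.ofReal_mul (by positivity), ← ENNReal.ofReal_add (by positivity) (by positivity)]
    refine ENNReal.ofReal_le_ofReal ?_
    rw [← inv_pow, ← inv_pow]
    nlinarith [sq_nonneg (x⁻¹ - y⁻¹), inv_pos.2 hx0, inv_pos.2 hy0, mul_pos (inv_pos.2 hx0) (inv_pos.2 hy0)]
  · calc _ ≤ 4 * ENNReal.ofReal (2 / t) := by
          gcongr
          exact tsum_le_of_real_sum_le (fun n => by positivity) (sum_inv_sq_le ht)
      _ = ENNReal.ofReal (4 * (2 / t)) := by
          rw [ENNReal.ofReal_mul (by norm_num)]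
          norm_num
      _ = _ := by
          congr 1
          ring

/-- The origin of the logarithm: the terms `1 ≤ n ≤ N` sum to the harmonic number of `N` over `N`,
the term `n = 0` is `1 / N`, and the tail is at most `2 / N`. -/
theorem sum_inv_mul_max_le {N : ℕ} (hN : 1 ≤ N) (K : ℕ) :
    ∑ n ∈ Finset.range K, (max 1 (n : ℝ) * max (n : ℝ) N)⁻¹ ≤ (4 + Real.log N) / N := by
  have hN' : (1 : ℝ) ≤ N := by exact_mod_cast hN
  have hN0 : (0 : ℝ) < N := by linarith
  have hsub : Finset.range K ⊆ Finset.range (N + 1 + K) := by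
    intro i
    simp only [Finset.mem_range]
    omega
  refine (Finset.sum_le_sum_of_subset_of_nonneg hsub fun n _ _ => by positivity).trans ?_
  rw [Finset.sum_range_add, Finset.sum_range_succ']
  have h1 : ∑ n ∈ Finset.range N, (max 1 ((n + 1 : ℕ) : ℝ) * max ((n + 1 : ℕ) : ℝ) N)⁻¹
      ≤ (1 + Real.log N) / N := by
    have h2 := harmonic_le_one_add_log N
    rw [harmonic] at h2
    push_cast at h2
    rw [le_div_iff₀ hN0, Finset.sum_mul]
    refine le_trans (Finset.sum_le_sum fun n hn => ?_) h2
    have h3 : ((n + 1 : ℕ) : ℝ) ≤ N := by exact_mod_cast Finset.mem_range.1 hn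
    have h4 : (1 : ℝ) ≤ ((n + 1 : ℕ) : ℝ) := by simp
    rw [max_eq_right h4, max_eq_right h3, mul_inv, mul_assoc, inv_mul_cancel₀ hN0.ne', mul_one]
    push_cast
    exact le_rfl
  have h2 : ∑ n ∈ Finset.range K,
      (max 1 ((N + 1 + n : ℕ) : ℝ) * max ((N + 1 + n : ℕ) : ℝ) N)⁻¹ ≤ 2 / N := by
    refine le_trans (Finset.sum_le_sum fun n _ => ?_) ((sum_inv_sq_le (t := (N : ℝ) + 1)
      (by linarith) K).trans (div_le_div_of_nonneg_left (by norm_num) hN0 (by linarith)))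
    have h3 : (0 : ℝ) ≤ n := n.cast_nonneg
    push_cast
    rw [max_eq_right (by linarith), max_eq_left (by linarith), sq]
    rw [show (n : ℝ) + (N + 1) = N + 1 + n by ring]
  have h3 : (max 1 ((0 : ℕ) : ℝ) * max ((0 : ℕ) : ℝ) N)⁻¹ = 1 / N := by
    rw [Nat.cast_zero, max_eq_left zero_le_one, max_eq_right hN0.le, one_mul, one_div]
  rw [h3]
  have h4 : (4 + Real.log N) / N = (1 + Real.log N) / N + 1 / N + 2 / N := by ring
  linarith

/-- Since `⟨m⟩ ≤ ⟨k⟩ + ⟨m + k⟩`, the larger of the two brackets is at least half the maximum of the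
smaller one and `⟨m⟩`. This decouples the product into sums over one variable. -/
theorem tsum_bracket_inv_le (m : ℤ) :
    ∑' k : ℤ, (ENNReal.ofReal (bracket k))⁻¹ * (ENNReal.ofReal (bracket (m + k)))⁻¹
      ≤ ENNReal.ofReal (64 * (Real.log (bracket m + 1) / bracket m)) := by
  set N : ℕ := max 1 m.natAbs with hNdef
  have hN : 1 ≤ N := le_max_left _ _
  have hbr (k : ℤ) : bracket k = max 1 (k.natAbs : ℝ) := by rw [natAbs_cast_real]; rfl
  have hNm : bracket m = N := by
    rw [hbr, hNdef]
    push_cast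
    rfl
  have hN0 : (0 : ℝ) < N := by exact_mod_cast hN
  refine (tsum_shift_le
    (g := fun n => ENNReal.ofReal (2 * (max 1 (n : ℝ) * max (n : ℝ) N)⁻¹))
    (x := fun k l => (ENNReal.ofReal (bracket k))⁻¹ * (ENNReal.ofReal (bracket l))⁻¹)
    fun k => ?_).trans ?_
  · have hmax (k : ℤ) : max (k.natAbs : ℝ) N = max (bracket k) N := by
      rw [hbr, max_comm 1, max_assoc, max_eq_right (a := (1 : ℝ)) (by exact_mod_cast hN)]
    rw [hmax, hmax, ← hbr, ← hbr, ← hNm]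
    have hx0 := bracket_pos k
    have hy0 := bracket_pos (m + k)
    have hm0 := bracket_pos m
    have htri : bracket m ≤ bracket k + bracket (m + k) := by
      refine max_le ?_ ?_
      · linarith [one_le_bracket k]
      · have h1 : (m : ℝ) = ((m + k : ℤ) : ℝ) - (k : ℝ) := by push_cast; ring
        have h2 := abs_sub ((m + k : ℤ) : ℝ) (k : ℝ)
        rw [← h1] at h2
        have h3 : |(k : ℝ)| ≤ bracket k := le_max_right _ _
        have h4 : |((m + k : ℤ) : ℝ)| ≤ bracket (m + k) := le_max_right _ _
        linarith
    rw [← ENNReal.ofReal_inv_of_pos hx0, ← ENNReal.ofReal_inv_of_pos hy0,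
      ← ENNReal.ofReal_mul (inv_nonneg.2 hx0.le), ← ENNReal.ofReal_add
      (mul_nonneg zero_le_two (inv_nonneg.2 (mul_nonneg hx0.le (le_max_of_le_left hx0.le))))
      (mul_nonneg zero_le_two (inv_nonneg.2 (mul_nonneg hy0.le (le_max_of_le_left hy0.le))))]
    refine ENNReal.ofReal_le_ofReal ?_
    rw [← mul_inv]
    set x := bracket k
    set y := bracket (m + k)
    set z := bracket m
    have main {x y : ℝ} (hx0 : 0 < x) (hxy : x ≤ y) (htri : z ≤ x + y) :
        (x * y)⁻¹ ≤ 2 * (x * max x z)⁻¹ := by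
      have hm : 0 < max x z := lt_max_of_lt_left hx0
      have hy0 : 0 < y := hx0.trans_le hxy
      rw [← div_eq_mul_inv, inv_eq_one_div, div_le_div_iff₀ (by positivity) (by positivity)]
      have : max x z ≤ 2 * y := max_le (by linarith) (by linarith)
      nlinarith
    rcases le_total x y with hxy | hxy
    · have h1 := main hx0 hxy htri
      have : 0 ≤ 2 * (y * max y z)⁻¹ := by positivity
      linarith
    · have h1 := main hy0 hxy (by linarith)
      rw [mul_comm y x] at h1
      have : 0 ≤ 2 * (x * max x z)⁻¹ := by positivity
      linarith
  · have h1 (K : ℕ) : ∑ n ∈ Finset.range K, 2 * (max 1 (n : ℝ) * max (n : ℝ) N)⁻¹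
        ≤ 2 * ((4 + Real.log N) / N) := by
      rw [← Finset.mul_sum]
      exact mul_le_mul_of_nonneg_left (sum_inv_mul_max_le hN K) zero_le_two
    calc _ ≤ 4 * ENNReal.ofReal (2 * ((4 + Real.log N) / N)) := by
          gcongr
          exact tsum_le_of_real_sum_le (fun n => by positivity) h1
      _ = ENNReal.ofReal (4 * (2 * ((4 + Real.log N) / N))) := by
          rw [ENNReal.ofReal_mul (by norm_num : (0 : ℝ) ≤ 4)]
          norm_num
      _ ≤ _ := by
          refine ENNReal.ofReal_le_ofReal ?_
          rw [hNm]
          have h2 : Real.log N ≤ Real.log (N + 1) := Real.log_le_log hN0 (by linarith)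
          have h3 : Real.log 2 ≤ Real.log (N + 1) :=
            Real.log_le_log (by norm_num) (by
              have : (1 : ℝ) ≤ N := by exact_mod_cast hN
              linarith)
          have h4 := Real.log_two_gt_d9
          -- One logarithm absorbs `log N`; the other seven absorb `4`, as `7 log 2 > 4`.
          have h5 : 4 + Real.log N ≤ 8 * Real.log (N + 1) := by linarith
          calc 4 * (2 * ((4 + Real.log N) / N)) = 8 * ((4 + Real.log N) / N) := by ring
            _ ≤ 8 * (8 * Real.log (N + 1) / N) := by gcongr
            _ = _ := by ring

end WeightSums

/-! ### Product estimates in Sobolev norms -/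

section Norms

variable {β : ℝ} {γ : ℕ}

/-- The weighted sum `∑ n, w(n) |û(n)|²` with values in `[0, ∞]`. -/
def esum (w : ℤ → ℝ) (u : FourierSeries) : ℝ≥0∞ := ∑' n, ENNReal.ofReal (w n) * ‖u n‖ₑ ^ 2

theorem esum_eq (w : ℤ → ℝ) (u : FourierSeries) (hw : ∀ n, 0 ≤ w n) :
    esum w u = ∑' n, ENNReal.ofReal (w n * ‖u n‖ ^ 2) := by
  refine tsum_congr fun n => ?_
  rw [ENNReal.ofReal_mul (hw n), ENNReal.ofReal_pow (norm_nonneg _), ofReal_norm]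

theorem mem_Sob_iff_esum {u : FourierSeries} : u ∈ Sob β γ ↔ esum (weight β γ) u ≠ ⊤ := by
  have h0 (n : ℤ) : 0 ≤ weight β γ n * ‖u n‖ ^ 2 := mul_nonneg (weight_pos _ _ n).le (sq_nonneg _)
  rw [mem_Sob_iff, esum_eq _ _ fun n => (weight_pos β γ n).le]
  constructor
  · exact fun h => h.tsum_ofReal_ne_top
  · intro h
    have := ENNReal.summable_toReal h
    simpa only [ENNReal.toReal_ofReal (h0 _)] using this

theorem Sob.enorm_sq (u : Sob β γ) : ‖u‖ₑ ^ 2 = esum (weight β γ) u.1 := by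
  rw [esum_eq _ _ fun n => (weight_pos β γ n).le, ← ENNReal.ofReal_tsum_of_nonneg
    (fun n => mul_nonneg (weight_pos _ _ n).le (sq_nonneg _)) (mem_Sob_iff.1 u.2), ← Sob.norm_sq,
    ENNReal.ofReal_pow (norm_nonneg _), ofReal_norm]

theorem Hardy.enorm_sq (f : Hardy β) : ‖f‖ₑ ^ 2 = esum (weight β 0) f.1.1 := Sob.enorm_sq f.1

theorem esum_mono {w w' : ℤ → ℝ} {u v : FourierSeries}
    (h : ∀ n, ENNReal.ofReal (w n) * ‖u n‖ₑ ^ 2 ≤ ENNReal.ofReal (w' n) * ‖v n‖ₑ ^ 2) :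
    esum w u ≤ esum w' v := ENNReal.tsum_le_tsum h

theorem norm_le_of_enorm_sq_le {X Y Z : Type*} [NormedAddCommGroup X] [NormedAddCommGroup Y]
    [NormedAddCommGroup Z] {x : X} {y : Y} {z : Z} {c : ℝ} (hc : 0 ≤ c)
    (h : ‖x‖ₑ ^ 2 ≤ ENNReal.ofReal (c ^ 2) * ‖y‖ₑ ^ 2 * ‖z‖ₑ ^ 2) : ‖x‖ ≤ c * ‖y‖ * ‖z‖ := by
  rw [← ofReal_norm, ← ofReal_norm, ← ofReal_norm, ← ENNReal.ofReal_pow (norm_nonneg _),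
    ← ENNReal.ofReal_pow (norm_nonneg _), ← ENNReal.ofReal_pow (norm_nonneg _),
    ← ENNReal.ofReal_mul (by positivity), ← ENNReal.ofReal_mul (by positivity),
    ENNReal.ofReal_le_ofReal_iff (by positivity), ← mul_pow, ← mul_pow] at h
  exact le_of_sq_le_sq h (by positivity)

theorem norm_le_of_enorm_sq_le' {X Y : Type*} [NormedAddCommGroup X] [NormedAddCommGroup Y]
    {x : X} {y : Y} {c : ℝ} (hc : 0 ≤ c)
    (h : ‖x‖ₑ ^ 2 ≤ ENNReal.ofReal (c ^ 2) * ‖y‖ₑ ^ 2) : ‖x‖ ≤ c * ‖y‖ := by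
  have := norm_le_of_enorm_sq_le (z := (1 : ℂ)) hc (x := x) (y := y) (by simpa using h)
  simpa using this

theorem weight_neg_half (n : ℤ) : weight (-1 / 2) 0 n = (bracket n)⁻¹ := by
  have e1 : (2 : ℝ) * (-1 / 2) = -1 := by norm_num
  simp only [weight, pow_zero, mul_one, e1, Real.rpow_neg_one]

theorem weight_half (n : ℤ) : weight (1 / 2) 0 n = bracket n := by
  have e1 : (2 : ℝ) * (1 / 2) = 1 := by norm_num
  simp only [weight, pow_zero, mul_one, e1, Real.rpow_one]

theorem weight_neg_half_log (n : ℤ) :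
    weight (-1 / 2) 1 n = Real.log (bracket n + 1) / bracket n := by
  have e1 : (2 : ℝ) * (-1 / 2) = -1 := by norm_num
  simp only [weight, pow_one, e1, Real.rpow_neg_one]
  rw [inv_mul_eq_div]

theorem weight_zero_zero (n : ℤ) : weight 0 0 n = 1 := by simp [weight]

/-- The weighted `ℓ²` bound for products of Fourier series. -/
theorem esum_mul_le {p q r : ℤ → ℝ} {M : ℝ} (hp : ∀ n, 0 < p n) (hq : ∀ n, 0 < q n)
    (hr : ∀ n, 0 < r n)
    (hM : ∀ m, ∑' k, (ENNReal.ofReal (q k))⁻¹ * (ENNReal.ofReal (r (m + k)))⁻¹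
      ≤ ENNReal.ofReal M * ENNReal.ofReal (p m)) {u v : FourierSeries}
    (hu : esum p u ≠ ⊤) (hv : esum q v ≠ ⊤) :
    esum (fun n => (r n)⁻¹) (mul u v) ≤ ENNReal.ofReal M * esum p u * esum q v := by
  refine le_trans (ENNReal.tsum_le_tsum fun n => ?_)
    (tsum_conv_sq_le (a := fun n => ‖u n‖ₑ) (b := fun n => ‖v n‖ₑ)
      (p := fun n => ENNReal.ofReal (p n)) (q := fun n => ENNReal.ofReal (q n))
      (r := fun n => ENNReal.ofReal (r n)) (M := ENNReal.ofReal M)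
      (fun n => by simpa using hp n) (fun n => ENNReal.ofReal_ne_top)
      (fun n => by simpa using hq n) (fun n => ENNReal.ofReal_ne_top)
      (fun n => by simpa using hr n) (fun n => ENNReal.ofReal_ne_top) hM ENNReal.ofReal_ne_top
      hu hv)
  rw [ENNReal.ofReal_inv_of_pos (hr n)]
  gcongr
  simp_rw [← enorm_mul]
  exact enorm_tsum_le_tsum_enorm

/-- The multiplication estimate `H^{-1/2,√log} · H^{1/2} ⊆ H^{-1/2}`. -/
theorem isProductConstant_eight : IsProductConstant 8 := by
  intro u v
  -- `M = 64` bounds the squared norms, whence the constant `8`.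
  have h := esum_mul_le (p := weight (-1 / 2) 1) (q := weight (1 / 2) 0) (r := weight (1 / 2) 0)
    (M := 64) (weight_pos _ _) (weight_pos _ _) (weight_pos _ _) (fun m => by
      simp_rw [weight_half, weight_neg_half_log]
      rw [← ENNReal.ofReal_mul (by norm_num)]
      exact tsum_bracket_inv_le m)
    (mem_Sob_iff_esum.1 u.2) (mem_Sob_iff_esum.1 v.2)
  have e : (fun n => (weight (1 / 2) 0 n)⁻¹) = weight (-1 / 2) 0 := by
    funext n
    rw [weight_half, weight_neg_half]
  rw [e] at h
  have hmem : mul u.1 v.1 ∈ Sob (-1 / 2) 0 := mem_Sob_iff_esum.2 (ne_top_of_le_ne_top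
    (ENNReal.mul_ne_top (ENNReal.mul_ne_top ENNReal.ofReal_ne_top (mem_Sob_iff_esum.1 u.2))
      (mem_Sob_iff_esum.1 v.2)) h)
  refine ⟨hmem, norm_le_of_enorm_sq_le (by norm_num) ?_⟩
  rw [Sob.enorm_sq, Sob.enorm_sq, Sob.enorm_sq]
  norm_num at h ⊢
  exact h

/-- The product estimate in the norms with the parameter `t`, for a square integrable factor. -/
theorem esum_mul_le_shifted {t : ℝ} (ht : 1 ≤ t) (u : Sob 0 0) {v : FourierSeries}
    (hv : esum (fun n => |(n : ℝ)| + t) v ≠ ⊤) :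
    esum (fun n => (|(n : ℝ)| + t)⁻¹) (mul u.1 v)
      ≤ ENNReal.ofReal (8 / t) * ‖u‖ₑ ^ 2 * esum (fun n => |(n : ℝ)| + t) v := by
  rw [Sob.enorm_sq]
  refine esum_mul_le (weight_pos 0 0) (fun n => by positivity) (fun n => by positivity)
    (fun m => ?_) (mem_Sob_iff_esum.1 u.2) hv
  rw [weight_zero_zero, ENNReal.ofReal_one, mul_one]
  exact tsum_shifted_inv_le ht m

end Norms

/-! ### Completeness, multipliers, compact inclusion and density -/

section Structure

variable {β β' : ℝ} {γ : ℕ}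

theorem toEll2_surjective (β : ℝ) (γ : ℕ) : Function.Surjective (toEll2 β γ) := by
  intro x
  let u : FourierSeries := fun n => ((Real.sqrt (weight β γ n) : ℝ) : ℂ)⁻¹ * x n
  have hu : weighted β γ u = x := by
    funext n
    have h2 : ((Real.sqrt (weight β γ n) : ℝ) : ℂ) ≠ 0 := by
      exact_mod_cast (Real.sqrt_pos.2 (weight_pos β γ n)).ne'
    exact mul_inv_cancel_left₀ h2 (x n)
  have hmem : u ∈ Sob β γ := memℓp_iff_finiteNorm.1 (by rw [hu]; exact x.2)
  exact ⟨⟨u, hmem⟩, Subtype.ext hu⟩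

/-- `Sob β γ` is isometric to `ℓ²(ℤ)`. -/
def toEll2Equiv (β : ℝ) (γ : ℕ) : Sob β γ ≃ₗᵢ[ℂ] lp (fun _ : ℤ => ℂ) 2 :=
  LinearIsometryEquiv.ofSurjective ⟨toEll2 β γ, fun _ => rfl⟩ (toEll2_surjective β γ)

instance (β : ℝ) (γ : ℕ) : CompleteSpace (Sob β γ) :=
  (completeSpace_congr (e := (toEll2Equiv β γ).toEquiv)
    (toEll2Equiv β γ).isometry.isUniformEmbedding).2 inferInstance

theorem norm_coeff_le (u : Sob β γ) (n : ℤ) : ‖u.1 n‖ ≤ (Real.sqrt (weight β γ n))⁻¹ * ‖u‖ := by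
  have h0 := Real.sqrt_pos.2 (weight_pos β γ n)
  have h : ‖weighted β γ u.1 n‖ ≤ ‖u‖ := lp.norm_apply_le_norm (by norm_num) (toEll2 β γ u) n
  have h1 : ‖weighted β γ u.1 n‖ = Real.sqrt (weight β γ n) * ‖u.1 n‖ := by
    change ‖((Real.sqrt (weight β γ n) : ℝ) : ℂ) * u.1 n‖ = _
    rw [norm_mul, Complex.norm_real, Real.norm_of_nonneg h0.le]
  rw [h1] at h
  rwa [inv_mul_eq_div, le_div_iff₀ h0, mul_comm]

/-- The `n`-th Fourier coefficient as a continuous functional. -/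
def coeff (β : ℝ) (γ : ℕ) (n : ℤ) : Sob β γ →L[ℂ] ℂ :=
  LinearMap.mkContinuous ⟨⟨fun u => u.1 n, fun _ _ => rfl⟩, fun _ _ => rfl⟩ _
    (fun u => norm_coeff_le u n)

/-- Needed for completeness of the Hardy spaces, on which the Neumann series and the Fredholm
alternative rest. -/
theorem isClosed_Hardy (β : ℝ) : IsClosed (Hardy β : Set (Sob β 0)) := by
  have : (Hardy β : Set (Sob β 0)) = ⋂ (n : ℤ) (_ : n < 0), {f | coeff β 0 n f = 0} := by
    ext f
    simp only [SetLike.mem_coe, mem_Hardy_iff, Set.mem_iInter, Set.mem_ofPred_eq]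
    rfl
  rw [this]
  exact isClosed_iInter fun n => isClosed_iInter fun _ =>
    isClosed_eq (coeff β 0 n).continuous continuous_const

instance (β : ℝ) : CompleteSpace (Hardy β) := (isClosed_Hardy β).completeSpace_coe

theorem Hardy.ext {f g : Hardy β} (h : ∀ n, 0 ≤ n → f.1.1 n = g.1.1 n) : f = g := by
  refine Subtype.ext (Subtype.ext ?_)
  funext n
  rcases le_or_gt 0 n with hn | hn
  · exact h n hn
  · rw [f.2 n hn, g.2 n hn]

theorem multiplier_le {a : ℤ → ℂ} {C : ℝ}
    (h : ∀ n, 0 ≤ n → ‖a n‖ ^ 2 * weight β' 0 n ≤ C ^ 2 * weight β 0 n) (f : Hardy β) :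
    esum (weight β' 0) (fun n => a n * f.1.1 n) ≤ ENNReal.ofReal (C ^ 2) * ‖f‖ₑ ^ 2 := by
  rw [Hardy.enorm_sq]
  unfold esum
  rw [← ENNReal.tsum_mul_left]
  refine ENNReal.tsum_le_tsum fun n => ?_
  rcases lt_or_ge n 0 with hn | hn
  · simp [f.2 n hn]
  · rw [enorm_mul, mul_pow, ← mul_assoc, ← mul_assoc, ← ENNReal.ofReal_mul (sq_nonneg C),
      ← ofReal_norm (a n), ← ENNReal.ofReal_pow (norm_nonneg _),
      ← ENNReal.ofReal_mul (weight_pos _ _ n).le, mul_comm (weight β' 0 n)]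
    exact mul_le_mul_left (ENNReal.ofReal_le_ofReal (h n hn)) _

/-- The Fourier multiplier with symbol `a`, as an operator between Hardy spaces. -/
def multiplier (β β' : ℝ) (a : ℤ → ℂ) {C : ℝ} (hC : 0 ≤ C)
    (h : ∀ n, 0 ≤ n → ‖a n‖ ^ 2 * weight β' 0 n ≤ C ^ 2 * weight β 0 n) :
    Hardy β →L[ℂ] Hardy β' :=
  LinearMap.mkContinuous
    { toFun := fun f => ⟨⟨fun n => a n * f.1.1 n, mem_Sob_iff_esum.2 (ne_top_of_le_ne_top
          (ENNReal.mul_ne_top ENNReal.ofReal_ne_top (by simp)) (multiplier_le h f))⟩,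
          fun n hn => by
            change a n * f.1.1 n = 0
            rw [f.2 n hn, mul_zero]⟩
      map_add' := fun f g => Subtype.ext (Subtype.ext (funext fun n => mul_add _ _ _))
      map_smul' := fun c f => Subtype.ext (Subtype.ext (funext fun n => mul_left_comm _ _ _)) } C
    (fun f => norm_le_of_enorm_sq_le' hC (by
      rw [Hardy.enorm_sq]
      exact multiplier_le h f))

theorem multiplier_apply {a : ℤ → ℂ} {C : ℝ} (hC : 0 ≤ C)
    (h : ∀ n, 0 ≤ n → ‖a n‖ ^ 2 * weight β' 0 n ≤ C ^ 2 * weight β 0 n) (f : Hardy β) (n : ℤ) :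
    (multiplier β β' a hC h f).1.1 n = a n * f.1.1 n := rfl

theorem norm_multiplier_le {a : ℤ → ℂ} {C : ℝ} (hC : 0 ≤ C)
    (h : ∀ n, 0 ≤ n → ‖a n‖ ^ 2 * weight β' 0 n ≤ C ^ 2 * weight β 0 n) :
    ‖multiplier β β' a hC h‖ ≤ C := LinearMap.mkContinuous_norm_le _ hC _

theorem inclHardy_coeff (f : Hardy (1 / 2)) : (inclHardy f).1.1 = f.1.1 := rfl

theorem mem_Sob_of_finite_support {u : FourierSeries} {S : Finset ℤ} (h : ∀ n ∉ S, u n = 0) :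
    u ∈ Sob β γ :=
  mem_Sob_iff.2 (summable_of_ne_finset_zero (s := S) fun n hn => by simp [h n hn])

/-- Trigonometric polynomials with given coefficients, as elements of the Hardy space. -/
def polyHardy (β : ℝ) (N : ℕ) : (Fin N → ℂ) →ₗ[ℂ] Hardy β where
  toFun c := ⟨⟨fun n => if h : 0 ≤ n ∧ n.toNat < N then c ⟨n.toNat, h.2⟩ else 0,
    mem_Sob_of_finite_support (S := Finset.Ico 0 (N : ℤ)) fun n hn => by
      rw [Finset.mem_Ico] at hn
      rw [dif_neg]
      omega⟩, fun n hn => by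
        change (if h : 0 ≤ n ∧ n.toNat < N then c ⟨n.toNat, h.2⟩ else 0) = 0
        rw [dif_neg]
        omega⟩
  map_add' c d := by
    refine Subtype.ext (Subtype.ext (funext fun n => ?_))
    change (dite _ _ _ : ℂ) = (dite _ _ _ : ℂ) + (dite _ _ _ : ℂ)
    split_ifs
    · rfl
    · rw [add_zero]
  map_smul' x c := by
    refine Subtype.ext (Subtype.ext (funext fun n => ?_))
    change (dite _ _ _ : ℂ) = x * (dite _ _ _ : ℂ)
    split_ifs
    · rfl
    · rw [mul_zero]

open Filter Topology in
theorem isCompactOperator_of_norm_sub_le {X Y : Type*} [NormedAddCommGroup X] [NormedSpace ℂ X]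
    [NormedAddCommGroup Y] [NormedSpace ℂ Y] [CompleteSpace Y] {T : X →L[ℂ] Y} {S : ℕ → X →L[ℂ] Y}
    (hc : ∀ N, IsCompactOperator (S N)) (hb : ∀ N : ℕ, ‖S N - T‖ ≤ 1 / ((N : ℝ) + 1)) :
    IsCompactOperator T :=
  isCompactOperator_of_tendsto (tendsto_iff_norm_sub_tendsto_zero.2
    (squeeze_zero (fun _ => norm_nonneg _) hb tendsto_one_div_add_atTop_nhds_zero_nat))
    (Eventually.of_forall hc)

/-- The inclusion `H^{1/2}_+ ⊆ H^{-1/2}_+` is compact. -/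
theorem isCompactOperator_inclHardy : IsCompactOperator inclHardy := by
  let A : (N : ℕ) → (Hardy (1 / 2) →L[ℂ] (Fin N → ℂ)) := fun N =>
    ContinuousLinearMap.pi fun i => (coeff (1 / 2) 0 ((i : ℕ) : ℤ)).comp (Hardy (1 / 2)).subtypeL
  let B : (N : ℕ) → ((Fin N → ℂ) →L[ℂ] Hardy (-1 / 2)) := fun N =>
    LinearMap.toContinuousLinearMap (polyHardy (-1 / 2) N)
  have hBA (N : ℕ) (f : Hardy (1 / 2)) (n : ℤ) (hn : 0 ≤ n) :
      (B N (A N f)).1.1 n = if n < N then f.1.1 n else 0 := by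
    change (if h : 0 ≤ n ∧ n.toNat < N then f.1.1 ((n.toNat : ℕ) : ℤ) else 0) = _
    by_cases h : n < N
    · rw [if_pos h, dif_pos (by omega), Int.toNat_of_nonneg hn]
    · rw [if_neg h, dif_neg (by omega)]
  have hc (N : ℕ) : IsCompactOperator (B N ∘L A N) :=
    (isCompactOperator_of_locallyCompactSpace_rng (B N)).comp_clm (A N)
  have hbound (N : ℕ) : ‖B (N + 1) ∘L A (N + 1) - inclHardy‖ ≤ 1 / ((N : ℝ) + 1) := by
    have hC : (0 : ℝ) ≤ 1 / ((N : ℝ) + 1) := by positivity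
    -- Truncation minus inclusion has symbol `-1` for `n ≥ N + 1`, where `⟨n⟩⁻¹ ≤ (N + 1)⁻² ⟨n⟩`,
    -- and `0` below.
    have hm : ∀ n : ℤ, 0 ≤ n → ‖if n < (N + 1 : ℕ) then (0 : ℂ) else -1‖ ^ 2 * weight (-1 / 2) 0 n
        ≤ (1 / ((N : ℝ) + 1)) ^ 2 * weight (1 / 2) 0 n := by
      intro n hn
      rw [weight_half, weight_neg_half]
      have hb := bracket_pos n
      split_ifs with h
      · rw [norm_zero, sq, zero_mul, zero_mul]
        positivity
      · have h1 : (N : ℝ) + 1 ≤ bracket n := by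
          have h2 : ((N + 1 : ℕ) : ℤ) ≤ n := not_lt.1 h
          have h3 : ((N + 1 : ℕ) : ℝ) ≤ (n : ℝ) := by exact_mod_cast h2
          push_cast at h3
          exact h3.trans ((le_abs_self _).trans (le_max_right _ _))
        have h4 : ((N : ℝ) + 1) ^ 2 ≤ bracket n ^ 2 := by gcongr
        rw [norm_neg, norm_one, one_pow, one_mul, div_pow, one_pow, one_div_mul_eq_div,
          inv_eq_one_div, div_le_div_iff₀ hb (by positivity)]
        linarith
    have he : B (N + 1) ∘L A (N + 1) - inclHardy = multiplier (1 / 2) (-1 / 2) _ hC hm := by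
      ext1 f
      refine Hardy.ext fun n hn => ?_
      rw [multiplier_apply]
      change (B (N + 1) (A (N + 1) f)).1.1 n - f.1.1 n = _
      rw [hBA _ _ _ hn]
      split_ifs <;> ring
    rw [he]
    exact norm_multiplier_le hC hm
  exact isCompactOperator_of_norm_sub_le (fun N => hc (N + 1)) hbound

/-- Square integrable functions are dense in `H^{-1/2,√log}_c`. -/
theorem exists_L2_near (u : Sob (-1 / 2) 1) {ε : ℝ} (hε : 0 < ε) :
    ∃ u₀ : Sob 0 0, ‖u - inclL2 u₀‖ < ε := by
  classical
  have hu := mem_Sob_iff.1 u.2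
  obtain ⟨S, hS⟩ := (Metric.tendsto_atTop.1 hu.hasSum) (ε ^ 2) (by positivity)
  let v : FourierSeries := fun n => if n ∈ S then u.1 n else 0
  have hv : v ∈ Sob 0 0 := mem_Sob_of_finite_support (S := S) fun n hn => if_neg hn
  refine ⟨⟨v, hv⟩, ?_⟩
  have h1 : ‖u - inclL2 ⟨v, hv⟩‖ ^ 2 = ∑' n, (weight (-1 / 2) 1 n * ‖u.1 n‖ ^ 2
      - if n ∈ S then weight (-1 / 2) 1 n * ‖u.1 n‖ ^ 2 else 0) := by
    rw [Sob.norm_sq]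
    refine tsum_congr fun n => ?_
    change weight (-1 / 2) 1 n * ‖u.1 n - (if n ∈ S then u.1 n else 0)‖ ^ 2 = _
    split_ifs <;> simp
  have h2 := hS S le_rfl
  have h3 : HasSum (fun n => if n ∈ S then weight (-1 / 2) 1 n * ‖u.1 n‖ ^ 2 else 0)
      (∑ n ∈ S, weight (-1 / 2) 1 n * ‖u.1 n‖ ^ 2) := by
    have := hasSum_sum_of_ne_finset_zero (s := S) (L := .unconditional ℤ)
      (f := fun n => if n ∈ S then weight (-1 / 2) 1 n * ‖u.1 n‖ ^ 2 else 0)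
      (fun n hn => if_neg hn)
    rwa [Finset.sum_congr rfl fun n hn => if_pos hn] at this
  rw [(hu.hasSum.sub h3).tsum_eq] at h1
  rw [Real.dist_eq, abs_sub_comm] at h2
  have h4 := (le_abs_self _).trans_lt h2
  rw [← h1] at h4
  exact lt_of_pow_lt_pow_left₀ 2 hε.le h4

end Structure

/-! ### The Toeplitz and Lax operators as bounded maps -/

section Toeplitz

variable {β : ℝ}

theorem esum_szego_le (w : ℤ → ℝ) (v : FourierSeries) : esum w (szego v) ≤ esum w v :=
  esum_mono fun n => by
    unfold szego
    split_ifs <;> simp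

/-- The Szegő projector from the Sobolev space to the Hardy space. -/
def szegoCLM (β : ℝ) : Sob β 0 →L[ℂ] Hardy β :=
  LinearMap.mkContinuous
    { toFun := fun v => ⟨⟨szego v.1, mem_Sob_iff_esum.2
        (ne_top_of_le_ne_top (mem_Sob_iff_esum.1 v.2) (esum_szego_le _ _))⟩, fun n hn => if_neg (not_le.2 hn)⟩
      map_add' := fun v w => Subtype.ext (Subtype.ext (funext fun n => by
        change (ite _ _ _ : ℂ) = (ite _ _ _ : ℂ) + (ite _ _ _ : ℂ)
        split_ifs
        · rfl
        · rw [add_zero]))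
      map_smul' := fun c v => Subtype.ext (Subtype.ext (funext fun n => by
        change (ite _ _ _ : ℂ) = c * (ite _ _ _ : ℂ)
        split_ifs
        · rfl
        · rw [mul_zero])) } 1
    (fun v => norm_le_of_enorm_sq_le' zero_le_one (by
      rw [one_pow, ENNReal.ofReal_one, one_mul, Hardy.enorm_sq, Sob.enorm_sq]
      exact esum_szego_le _ _))

theorem norm_szegoCLM_apply_le (v : Sob β 0) : ‖szegoCLM β v‖ ≤ ‖v‖ := by
  refine (norm_le_of_enorm_sq_le' zero_le_one ?_).trans_eq (one_mul _)
  rw [one_pow, ENNReal.ofReal_one, one_mul, Hardy.enorm_sq, Sob.enorm_sq]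
  exact esum_szego_le _ _

theorem mul_add_left {u u' v : FourierSeries} (hu : u ∈ Sob (-1 / 2) 0) (hu' : u' ∈ Sob (-1 / 2) 0)
    (hv : v ∈ Sob (1 / 2) 0) : mul (u + u') v = mul u v + mul u' v := by
  funext n
  simp only [mul, FourierSeries.add_apply, add_mul]
  exact (summable_mul hu hv n).tsum_add (summable_mul hu' hv n)

theorem mul_add_right {u v v' : FourierSeries} (hu : u ∈ Sob (-1 / 2) 0) (hv : v ∈ Sob (1 / 2) 0)
    (hv' : v' ∈ Sob (1 / 2) 0) : mul u (v + v') = mul u v + mul u v' := by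
  funext n
  simp only [mul, FourierSeries.add_apply, mul_add]
  exact (summable_mul hu hv n).tsum_add (summable_mul hu hv' n)

theorem mul_smul_left (c : ℂ) (u v : FourierSeries) : mul (c • u) v = c • mul u v := by
  funext n
  simp only [mul, FourierSeries.smul_apply, mul_assoc]
  exact tsum_mul_left

theorem mul_smul_right (c : ℂ) (u v : FourierSeries) : mul u (c • v) = c • mul u v := by
  funext n
  simp only [mul, FourierSeries.smul_apply, mul_left_comm _ c]
  exact tsum_mul_left

/-- The product of `u ∈ H^{-1/2,√log}_c` and `v ∈ H^{1/2}_c` in `H^{-1/2}_c`. -/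
def mulSob (u : Sob (-1 / 2) 1) (v : Sob (1 / 2) 0) : Sob (-1 / 2) 0 :=
  ⟨mul u.1 v.1, (isProductConstant_eight u v).1⟩

theorem norm_mulSob_le {K : ℝ} (hK : IsProductConstant K) (u : Sob (-1 / 2) 1)
    (v : Sob (1 / 2) 0) : ‖mulSob u v‖ ≤ K * ‖u‖ * ‖v‖ := (hK u v).2

/-- The Toeplitz operator `T_u : H^{1/2}_+ → H^{-1/2}_+`, in its dependence on `u`. -/
def toeplitzCLM : Sob (-1 / 2) 1 →L[ℂ] Hardy (1 / 2) →L[ℂ] Hardy (-1 / 2) :=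
  LinearMap.mkContinuous₂ (LinearMap.mk₂ ℂ (fun u f => szegoCLM (-1 / 2) (mulSob u f.1))
    (fun u u' f => by
      rw [← map_add]
      exact congrArg _ (Subtype.ext
        (mul_add_left (mem_of_mem_log u.2) (mem_of_mem_log u'.2) f.1.2)))
    (fun c u f => by
      rw [← map_smul]
      exact congrArg _ (Subtype.ext (mul_smul_left c u.1 f.1.1)))
    (fun u f f' => by
      rw [← map_add]
      exact congrArg _ (Subtype.ext (mul_add_right (mem_of_mem_log u.2) f.1.2 f'.1.2)))
    (fun c u f => by
      rw [← map_smul]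
      exact congrArg _ (Subtype.ext (mul_smul_right c u.1 f.1.1)))) 8
    (fun u f => (norm_szegoCLM_apply_le _).trans (norm_mulSob_le isProductConstant_eight u f.1))

theorem norm_toeplitzCLM_apply_le {K : ℝ} (hK : IsProductConstant K) (u : Sob (-1 / 2) 1)
    (f : Hardy (1 / 2)) : ‖toeplitzCLM u f‖ ≤ K * ‖u‖ * ‖f‖ :=
  (norm_szegoCLM_apply_le _).trans (norm_mulSob_le hK u f.1)

theorem multiplier_bound_D (z : ℂ) (n : ℤ) (_ : 0 ≤ n) :
    ‖(n : ℂ) - z‖ ^ 2 * weight (-1 / 2) 0 n ≤ (1 + ‖z‖) ^ 2 * weight (1 / 2) 0 n := by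
  rw [weight_half, weight_neg_half]
  have h1 := one_le_bracket n
  have h0 := bracket_pos n
  have h2 : ‖(n : ℂ) - z‖ ≤ (1 + ‖z‖) * bracket n := by
    have h3 : ‖(n : ℂ)‖ ≤ bracket n := by
      rw [Complex.norm_intCast]
      exact le_max_right _ _
    have := norm_sub_le (n : ℂ) z
    nlinarith [norm_nonneg z]
  calc ‖(n : ℂ) - z‖ ^ 2 * (bracket n)⁻¹ ≤ ((1 + ‖z‖) * bracket n) ^ 2 * (bracket n)⁻¹ := by gcongr
    _ = _ := by field_simp

/-- The operator `D - z : H^{1/2}_+ → H^{-1/2}_+`. -/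
def opDsub (z : ℂ) : Hardy (1 / 2) →L[ℂ] Hardy (-1 / 2) :=
  multiplier (1 / 2) (-1 / 2) (fun n => (n : ℂ) - z) (by positivity) (multiplier_bound_D z)

theorem opDsub_eq (z : ℂ) : opDsub z = opDsub 0 - z • inclHardy := by
  ext1 f
  refine Hardy.ext fun n _ => ?_
  change ((n : ℂ) - z) * f.1.1 n = ((n : ℂ) - 0) * f.1.1 n - z * f.1.1 n
  ring

/-- The operator `L_u - z : H^{1/2}_+ → H^{-1/2}_+`. -/
def laxSub (p : Sob (-1 / 2) 1 × ℂ) : Hardy (1 / 2) →L[ℂ] Hardy (-1 / 2) :=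
  opDsub p.2 - toeplitzCLM p.1

/-- The multiplication estimate enters through `toeplitzCLM`: it puts `T_u f` in `H^{-1/2}_+`, so
membership in the domain of `lax u` is automatic. -/
theorem inclHardy_mem_domain (u : Sob (-1 / 2) 1) (f : Hardy (1 / 2)) :
    inclHardy f ∈ (lax u).domain := by
  refine ⟨f.1.2, ?_⟩
  have : laxExpr u.1 f.1.1 = (opDsub 0 f - toeplitzCLM u f).1.1 := by
    funext n
    change (n : ℂ) * f.1.1 n - _ = ((n : ℂ) - 0) * f.1.1 n - _
    rw [sub_zero]
    rfl
  rw [inclHardy_coeff, this]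
  exact (opDsub 0 f - toeplitzCLM u f).1.2

theorem domain_lax (u : Sob (-1 / 2) 1) : (lax u).domain = inclHardy.range := by
  ext f
  constructor
  · intro hf
    exact ⟨⟨⟨f.1.1, hf.1⟩, f.2⟩, rfl⟩
  · rintro ⟨g, rfl⟩
    exact inclHardy_mem_domain u g

theorem lax_sub_smul (u : Sob (-1 / 2) 1) (z : ℂ) (f : Hardy (1 / 2))
    (h : inclHardy f ∈ (lax u).domain) :
    lax u ⟨inclHardy f, h⟩ - z • inclHardy f = laxSub (u, z) f := by
  refine Hardy.ext fun n _ => ?_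
  change ((n : ℂ) * f.1.1 n - toeplitz u.1 f.1.1 n) - z * f.1.1 n
    = ((n : ℂ) - z) * f.1.1 n - toeplitz u.1 f.1.1 n
  ring

theorem isResolventAt_of_inverse {u : Sob (-1 / 2) 1} {z : ℂ}
    {R : Hardy (-1 / 2) →L[ℂ] Hardy (1 / 2)} (h1 : ∀ x, laxSub (u, z) (R x) = x)
    (h2 : ∀ f, R (laxSub (u, z) f) = f) : IsResolventAt (lax u) z (inclHardy.comp R) := by
  constructor
  · intro x
    refine ⟨inclHardy_mem_domain u (R x), ?_⟩
    exact (lax_sub_smul u z (R x) _).trans (h1 x)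
  · rintro ⟨y, hy⟩
    obtain ⟨g, rfl⟩ : y ∈ inclHardy.range := by rwa [← domain_lax u]
    change inclHardy (R (lax u ⟨inclHardy g, hy⟩ - z • inclHardy g)) = inclHardy g
    rw [lax_sub_smul, h2]

end Toeplitz

/-! ### Inversion by conjugation, and its analyticity -/

section Inverse

open scoped ContDiff

variable {W X Y : Type*} [NormedAddCommGroup W] [NormedSpace ℂ W] [NormedAddCommGroup X]
  [NormedSpace ℂ X] [NormedAddCommGroup Y] [NormedSpace ℂ Y]

theorem inverse_eq_of_inverse {P : Y →L[ℂ] X} {R : X →L[ℂ] Y} (h1 : ∀ x, P (R x) = x)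
    (h2 : ∀ y, R (P y) = y) : P.inverse = R := by
  exact ContinuousLinearMap.inverse_equiv (ContinuousLinearEquiv.equivOfInverse P R h2 h1)

theorem analyticAt_inverse_of_inverse [CompleteSpace Y] {F : W → Y →L[ℂ] X} {w : W}
    {R : X →L[ℂ] Y} (h1 : ∀ x, F w (R x) = x) (h2 : ∀ y, R (F w y) = y) (hF : AnalyticAt ℂ F w) :
    AnalyticAt ℂ (fun w => (F w).inverse) w := by
  have h : (F w).IsInvertible := ⟨ContinuousLinearEquiv.equivOfInverse (F w) R h2 h1, rfl⟩
  exact AnalyticAt.comp (g := ContinuousLinearMap.inverse)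
    (h.contDiffAt_map_inverse (n := ω)).analyticAt hF

theorem analyticAt_affine (A B : Y →L[ℂ] X) (T : W →L[ℂ] Y →L[ℂ] X) (p : W × ℂ) :
    AnalyticAt ℂ (fun p : W × ℂ => A - p.2 • B - T p.1) p := by
  have h : AnalyticAt ℂ (fun p : W × ℂ => T p.1) p :=
    (T ∘L ContinuousLinearMap.fst ℂ W ℂ).analyticAt p
  exact ((analyticAt_const.sub (analyticAt_snd.smul analyticAt_const)).sub h)

/-- An operator `G⁻¹ - T` is invertible when `T G` is a contraction after conjugation. -/
theorem exists_inverse_of_conj [CompleteSpace X] {D T : Y →L[ℂ] X} {G : X →L[ℂ] Y}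
    {U V : X →L[ℂ] X} (hDG : ∀ x, D (G x) = x) (hGD : ∀ y, G (D y) = y)
    (hVU : ∀ x, V (U x) = x) {c : ℝ} (hc0 : 0 ≤ c) (hc : c < 1)
    (h : ∀ x, ‖U (T (G (V x)))‖ ≤ c * ‖x‖) :
    ∃ R : X →L[ℂ] Y, (∀ x, (D - T) (R x) = x) ∧ ∀ y, R ((D - T) y) = y := by
  -- The inverse of `D - T` is `G V (1 - B)⁻¹ U`; only `V U = 1` is needed.
  set B : X →L[ℂ] X := U ∘L T ∘L G ∘L V with hB
  have hBn : ‖B‖ < 1 := (ContinuousLinearMap.opNorm_le_bound _ hc0 h).trans_lt hc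
  set S : (X →L[ℂ] X)ˣ := Units.oneSub B hBn
  have hS : (S : X →L[ℂ] X) = 1 - B := rfl
  set S' : X →L[ℂ] X := Units.val S⁻¹ with hS'
  have e1 (x : X) : S' x - U (T (G (V (S' x)))) = x := by
    have h1 : (1 - B) * S' = 1 := by rw [← hS, hS', Units.mul_inv]
    exact congrArg (fun Q : X →L[ℂ] X => Q x) h1
  have e2 (x : X) : S' (x - U (T (G (V x)))) = x := by
    have h1 : S' * (1 - B) = 1 := by rw [← hS, hS', Units.inv_mul]
    exact congrArg (fun Q : X →L[ℂ] X => Q x) h1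
  refine ⟨G ∘L V ∘L S' ∘L U, fun x => ?_, fun y => ?_⟩
  · change D (G (V (S' (U x)))) - T (G (V (S' (U x)))) = x
    have h1 := congrArg V (e1 (U x))
    rwa [map_sub, hVU, hVU, ← hDG (V (S' (U x))), hGD] at h1
  · change G (V (S' (U (D y - T y)))) = y
    have h1 : U (D y - T y) = U (D y) - U (T (G (V (U (D y))))) := by
      rw [hVU, hGD, map_sub]
    rw [h1, e2, hVU, hGD]

end Inverse

/-! ### Invertibility in the half-plane -/

section HalfPlane

variable {t : ℝ} {z : ℂ}

theorem bracket_le_shifted (ht : 1 ≤ t) (n : ℤ) : bracket n ≤ |(n : ℝ)| + t :=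
  max_le (by linarith [abs_nonneg (n : ℝ)]) (by linarith)

/-- The square root of `⟨n⟩ / (|n| + t)`. -/
def ratio (t : ℝ) (n : ℤ) : ℝ := Real.sqrt (bracket n / (|(n : ℝ)| + t))

theorem ratio_sq (ht : 1 ≤ t) (n : ℤ) : ratio t n ^ 2 = bracket n / (|(n : ℝ)| + t) :=
  Real.sq_sqrt (div_nonneg (bracket_pos n).le (by linarith [abs_nonneg (n : ℝ)]))

theorem ratio_pos (ht : 1 ≤ t) (n : ℤ) : 0 < ratio t n :=
  Real.sqrt_pos.2 (div_pos (bracket_pos n) (by linarith [abs_nonneg (n : ℝ)]))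

theorem norm_ratio_sq (ht : 1 ≤ t) (n : ℤ) :
    ‖(ratio t n : ℂ)‖ ^ 2 = bracket n / (|(n : ℝ)| + t) := by
  rw [Complex.norm_real, Real.norm_eq_abs, sq_abs, ratio_sq ht]

theorem norm_inv_ratio_sq (ht : 1 ≤ t) (n : ℤ) :
    ‖((ratio t n)⁻¹ : ℂ)‖ ^ 2 = (|(n : ℝ)| + t) / bracket n := by
  rw [norm_inv, inv_pow, norm_ratio_sq ht, inv_div]

theorem multiplier_bound_ratio (ht : 1 ≤ t) (n : ℤ) (_ : 0 ≤ n) :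
    ‖(ratio t n : ℂ)‖ ^ 2 * weight (-1 / 2) 0 n ≤ 1 ^ 2 * weight (-1 / 2) 0 n := by
  have h := bracket_le_shifted ht n
  have h0 := bracket_pos n
  rw [norm_ratio_sq ht, one_pow]
  exact mul_le_mul_of_nonneg_right ((div_le_one (h0.trans_le h)).2 h) (weight_pos _ _ n).le

/-- The growth in `t` is harmless: only boundedness of `conjOpInv` is used, never the size of its
norm. -/
theorem multiplier_bound_inv_ratio (ht : 1 ≤ t) (n : ℤ) (_ : 0 ≤ n) :
    ‖((ratio t n)⁻¹ : ℂ)‖ ^ 2 * weight (-1 / 2) 0 n ≤ (1 + t) ^ 2 * weight (-1 / 2) 0 n := by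
  have h0 := bracket_pos n
  have h1 := one_le_bracket n
  have h2 : |(n : ℝ)| ≤ bracket n := le_max_right _ _
  rw [norm_inv_ratio_sq ht]
  refine mul_le_mul_of_nonneg_right ?_ (weight_pos _ _ n).le
  rw [div_le_iff₀ h0]
  have h3 : t ≤ t * bracket n := le_mul_of_one_le_right (by linarith) h1
  have h4 : (1 + t) * bracket n ≤ (1 + t) ^ 2 * bracket n :=
    mul_le_mul_of_nonneg_right (le_self_pow₀ (by linarith) two_ne_zero) h0.le
  linarith

/-- For `n ≥ 0` the real part of `n - z` is `|n| + t`; this is where the restriction to nonnegative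
frequencies helps. -/
theorem shifted_le_norm_sub (ht : z.re = -t) {n : ℤ} (hn : 0 ≤ n) :
    |(n : ℝ)| + t ≤ ‖(n : ℂ) - z‖ := by
  have h1 := Complex.re_le_norm ((n : ℂ) - z)
  rw [Complex.sub_re, Complex.intCast_re, ht] at h1
  rw [abs_of_nonneg (by exact_mod_cast hn)]
  linarith

theorem multiplier_bound_inv (ht : 1 ≤ t) (hz : z.re = -t) (n : ℤ) (hn : 0 ≤ n) :
    ‖((n : ℂ) - z)⁻¹‖ ^ 2 * weight (1 / 2) 0 n ≤ 1 ^ 2 * weight (-1 / 2) 0 n := by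
  have h1 := (bracket_le_shifted ht n).trans (shifted_le_norm_sub hz hn)
  have h0 := bracket_pos n
  rw [weight_half, weight_neg_half, one_pow, one_mul, norm_inv]
  calc ‖(n : ℂ) - z‖⁻¹ ^ 2 * bracket n ≤ (bracket n)⁻¹ ^ 2 * bracket n := by gcongr
    _ = _ := by field_simp

/-- The operator `(D - z)⁻¹ : H^{-1/2}_+ → H^{1/2}_+`. -/
def invDsub (ht : 1 ≤ t) (hz : z.re = -t) : Hardy (-1 / 2) →L[ℂ] Hardy (1 / 2) :=
  multiplier (-1 / 2) (1 / 2) (fun n => ((n : ℂ) - z)⁻¹) zero_le_one (multiplier_bound_inv ht hz)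

/-- The operator on `H^{-1/2}_+` that passes to the norm with the weight `(|n| + t)⁻¹`. -/
def conjOp (ht : 1 ≤ t) : Hardy (-1 / 2) →L[ℂ] Hardy (-1 / 2) :=
  multiplier (-1 / 2) (-1 / 2) (fun n => (ratio t n : ℂ)) zero_le_one (multiplier_bound_ratio ht)

/-- The inverse of `conjOp`. -/
def conjOpInv (ht : 1 ≤ t) : Hardy (-1 / 2) →L[ℂ] Hardy (-1 / 2) :=
  multiplier (-1 / 2) (-1 / 2) (fun n => ((ratio t n)⁻¹ : ℂ)) (by positivity)
    (multiplier_bound_inv_ratio ht)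

theorem conjOpInv_conjOp (ht : 1 ≤ t) (x : Hardy (-1 / 2)) : conjOpInv ht (conjOp ht x) = x := by
  refine Hardy.ext fun n _ => ?_
  have h : (ratio t n : ℂ) ≠ 0 := by exact_mod_cast (ratio_pos ht n).ne'
  exact inv_mul_cancel_left₀ h _

theorem sub_ne_zero_of_re (ht : 1 ≤ t) (hz : z.re = -t) {n : ℤ} (hn : 0 ≤ n) :
    (n : ℂ) - z ≠ 0 :=
  norm_pos_iff.1 ((bracket_pos n).trans_le
    ((bracket_le_shifted ht n).trans (shifted_le_norm_sub hz hn)))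

theorem opDsub_invDsub (ht : 1 ≤ t) (hz : z.re = -t) (x : Hardy (-1 / 2)) :
    opDsub z (invDsub ht hz x) = x :=
  Hardy.ext fun _ hn => mul_inv_cancel_left₀ (sub_ne_zero_of_re ht hz hn) _

theorem invDsub_opDsub (ht : 1 ≤ t) (hz : z.re = -t) (f : Hardy (1 / 2)) :
    invDsub ht hz (opDsub z f) = f :=
  Hardy.ext fun _ hn => inv_mul_cancel_left₀ (sub_ne_zero_of_re ht hz hn) _

/-- `(D - z)⁻¹` is a contraction between the shifted spaces. The weights combine to `(|n| + t) (|n|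
+ t)⁻² (|n| + t) / ⟨n⟩ = ⟨n⟩⁻¹`. -/
theorem esum_invDsub_le (ht : 1 ≤ t) (hz : z.re = -t) (x : Hardy (-1 / 2)) :
    esum (fun n => |(n : ℝ)| + t) (invDsub ht hz (conjOpInv ht x)).1.1 ≤ ‖x‖ₑ ^ 2 := by
  rw [Hardy.enorm_sq]
  refine esum_mono fun n => ?_
  change ENNReal.ofReal (|(n : ℝ)| + t) * ‖((n : ℂ) - z)⁻¹ * ((ratio t n : ℂ)⁻¹ * x.1.1 n)‖ₑ ^ 2 ≤ _
  rcases lt_or_ge n 0 with hn | hn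
  · simp [x.2 n hn]
  · have hs : 0 < |(n : ℝ)| + t := by positivity
    have h0 := bracket_pos n
    rw [← mul_assoc, enorm_mul, mul_pow, ← mul_assoc, ← ofReal_norm,
      ← ENNReal.ofReal_pow (norm_nonneg _), ← ENNReal.ofReal_mul hs.le]
    refine mul_le_mul_left (ENNReal.ofReal_le_ofReal ?_) _
    rw [norm_mul, mul_pow, norm_inv_ratio_sq ht, weight_neg_half, norm_inv]
    have h1 := shifted_le_norm_sub hz hn
    calc (|(n : ℝ)| + t) * (‖(n : ℂ) - z‖⁻¹ ^ 2 * ((|(n : ℝ)| + t) / bracket n))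
        ≤ (|(n : ℝ)| + t) * ((|(n : ℝ)| + t)⁻¹ ^ 2 * ((|(n : ℝ)| + t) / bracket n)) := by gcongr
      _ = _ := by field_simp

theorem norm_invDsub_le (ht : 1 ≤ t) (hz : z.re = -t) (x : Hardy (-1 / 2)) :
    ‖invDsub ht hz (conjOpInv ht x)‖ ≤ ‖x‖ := by
  refine (norm_le_of_enorm_sq_le' zero_le_one ?_).trans_eq (one_mul _)
  rw [one_pow, ENNReal.ofReal_one, one_mul, Hardy.enorm_sq]
  refine le_trans (esum_mono fun n => ?_) (esum_invDsub_le ht hz x)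
  rw [weight_half]
  gcongr
  exact bracket_le_shifted ht n

theorem norm_conjOp_le (ht : 1 ≤ t) (x : Hardy (-1 / 2)) : ‖conjOp ht x‖ ≤ ‖x‖ :=
  ((conjOp ht).le_of_opNorm_le (norm_multiplier_le zero_le_one (multiplier_bound_ratio ht))
    x).trans_eq (one_mul _)

/-- `conjOp` turns the weight `⟨n⟩⁻¹` into `(|n| + t)⁻¹`, so the shifted product estimate applies;
`32 ‖u‖² ≤ t` makes `8 ‖u‖² / t` at most `(1/2)²`. -/
theorem norm_conjOp_toeplitz_le (ht : 1 ≤ t) (hz : z.re = -t) (u : Sob 0 0)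
    (hu : 32 * ‖u‖ ^ 2 ≤ t) (x : Hardy (-1 / 2)) :
    ‖conjOp ht (toeplitzCLM (inclL2 u) (invDsub ht hz (conjOpInv ht x)))‖ ≤ 1 / 2 * ‖x‖ := by
  set y := invDsub ht hz (conjOpInv ht x) with hy
  have hyx : esum (fun n => |(n : ℝ)| + t) y.1.1 ≤ ‖x‖ₑ ^ 2 := esum_invDsub_le ht hz x
  have hyt : esum (fun n => |(n : ℝ)| + t) y.1.1 ≠ ⊤ := ne_top_of_le_ne_top (by simp) hyx
  refine norm_le_of_enorm_sq_le' (by norm_num) ?_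
  calc ‖conjOp ht (toeplitzCLM (inclL2 u) y)‖ₑ ^ 2
      ≤ esum (fun n => (|(n : ℝ)| + t)⁻¹) (szego (mul u.1 y.1.1)) := by
        rw [Hardy.enorm_sq]
        refine esum_mono fun n => ?_
        change ENNReal.ofReal (weight (-1 / 2) 0 n) * ‖(ratio t n : ℂ) * szego (mul u.1 y.1.1) n‖ₑ ^ 2
          ≤ _
        have h0 := bracket_pos n
        rw [enorm_mul, mul_pow, ← mul_assoc, ← ofReal_norm (ratio t n : ℂ),
          ← ENNReal.ofReal_pow (norm_nonneg _), ← ENNReal.ofReal_mul (weight_pos _ _ n).le,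
          norm_ratio_sq ht, weight_neg_half, inv_mul_eq_div, div_div, mul_comm _ (bracket n),
          div_mul_cancel_left₀ h0.ne']
    _ ≤ esum (fun n => (|(n : ℝ)| + t)⁻¹) (mul u.1 y.1.1) := esum_szego_le _ _
    _ ≤ ENNReal.ofReal (8 / t) * ‖u‖ₑ ^ 2 * esum (fun n => |(n : ℝ)| + t) y.1.1 :=
        esum_mul_le_shifted ht u hyt
    _ ≤ ENNReal.ofReal (8 / t) * ‖u‖ₑ ^ 2 * ‖x‖ₑ ^ 2 := by gcongr
    _ ≤ _ := by
        gcongr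
        rw [← ofReal_norm, ← ENNReal.ofReal_pow (norm_nonneg _), ← ENNReal.ofReal_mul (by positivity)]
        refine ENNReal.ofReal_le_ofReal ?_
        rw [div_mul_eq_mul_div, div_le_iff₀ (by linarith)]
        linarith

/-- Splitting `u = (u - u₀) + u₀` gives the contraction constant `1/4 + 1/2`. The half-plane ensures
both `t ≥ 1` and `t ≥ 32 ‖u₀‖²`, hence `C₀ = 32`. -/
theorem exists_inverse_laxSub {K : ℝ} (hK0 : 0 < K) (hK : IsProductConstant K) (u₀ : Sob 0 0)
    {u : Sob (-1 / 2) 1} (hu : u ∈ logBall K u₀) (hz : z ∈ halfPlane 32 u₀) :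
    ∃ R : Hardy (-1 / 2) →L[ℂ] Hardy (1 / 2),
      (∀ x, laxSub (u, z) (R x) = x) ∧ ∀ f, R (laxSub (u, z) f) = f := by
  obtain ⟨t, hzt⟩ : ∃ t : ℝ, z.re = -t := ⟨-z.re, (neg_neg _).symm⟩
  have hz' : z.re < -(1 + 32 * ‖u₀‖ * (1 + ‖u₀‖)) := hz
  have hn := norm_nonneg u₀
  have ht : 1 ≤ t := by nlinarith
  have ht2 : 32 * ‖u₀‖ ^ 2 ≤ t := by nlinarith
  refine exists_inverse_of_conj (opDsub_invDsub ht hzt) (invDsub_opDsub ht hzt)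
    (conjOpInv_conjOp ht) (c := 3 / 4) (by norm_num) (by norm_num) fun x => ?_
  set y := invDsub ht hzt (conjOpInv ht x) with hy
  have hyx : ‖y‖ ≤ ‖x‖ := norm_invDsub_le ht hzt x
  have h1 : ‖conjOp ht (toeplitzCLM (inclL2 u₀) y)‖ ≤ 1 / 2 * ‖x‖ :=
    norm_conjOp_toeplitz_le ht hzt u₀ ht2 x
  have h2 : ‖conjOp ht (toeplitzCLM (u - inclL2 u₀) y)‖ ≤ 1 / 4 * ‖x‖ := by
    have hu' : ‖u - inclL2 u₀‖ < 1 / (4 * K) := hu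
    have h3 : K * ‖u - inclL2 u₀‖ ≤ 1 / 4 := by
      rw [lt_div_iff₀ (by positivity)] at hu'
      linarith
    calc _ ≤ ‖toeplitzCLM (u - inclL2 u₀) y‖ := norm_conjOp_le ht _
      _ ≤ K * ‖u - inclL2 u₀‖ * ‖y‖ := norm_toeplitzCLM_apply_le hK _ _
      _ ≤ 1 / 4 * ‖x‖ := mul_le_mul h3 hyx (norm_nonneg _) (by norm_num)
  have h4 : toeplitzCLM u y = toeplitzCLM (u - inclL2 u₀) y + toeplitzCLM (inclL2 u₀) y := by
    rw [map_sub, sub_apply, sub_add_cancel]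
  rw [h4, map_add]
  refine (norm_add_le _ _).trans ?_
  linarith

end HalfPlane

/-! ### Analytic dependence and a resolvent point for every potential -/

theorem analyticAt_laxSub (p : Sob (-1 / 2) 1 × ℂ) : AnalyticAt ℂ laxSub p := by
  have h : laxSub = fun p => opDsub 0 - p.2 • inclHardy - toeplitzCLM p.1 := by
    funext p
    rw [laxSub, opDsub_eq]
  rw [h]
  exact analyticAt_affine (opDsub 0) inclHardy toeplitzCLM p

/-- An `L²` potential within `1 / (4 * 8)` of `u` places `u` in a ball for the product constant `8`;
the resulting resolvent factors through the compact inclusion. -/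
theorem exists_isResolventAt (u : Sob (-1 / 2) 1) :
    ∃ (z : ℂ) (R : Hardy (-1 / 2) →L[ℂ] Hardy (-1 / 2)),
      IsResolventAt (lax u) z R ∧ IsCompactOperator R := by
  obtain ⟨u₀, hu₀⟩ := exists_L2_near u (ε := 1 / (4 * 8)) (by norm_num)
  let z : ℂ := ((-(1 + 32 * ‖u₀‖ * (1 + ‖u₀‖)) - 1 : ℝ) : ℂ)
  have hz : z ∈ halfPlane 32 u₀ := by
    change z.re < _
    rw [Complex.ofReal_re]
    linarith
  obtain ⟨R, h1, h2⟩ := exists_inverse_laxSub (by norm_num) isProductConstant_eight u₀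
    (u := u) hu₀ hz
  exact ⟨z, inclHardy.comp R, isResolventAt_of_inverse h1 h2, isCompactOperator_inclHardy.comp_clm R⟩

end LaxBO

end

theorem mainTheorem6 :
    -- the multiplication estimate holds with some constant
    (∃ K₀ : ℝ, 0 < K₀ ∧ LaxBO.IsProductConstant K₀) ∧
    -- closedness, domain, compact resolvent, discrete spectrum
    (∀ u : LaxBO.Sob (-1 / 2) 1,
      (LaxBO.lax u).domain = LaxBO.inclHardy.range ∧
      (LaxBO.lax u).IsClosed ∧
      LaxBO.HasCompactResolvent (LaxBO.lax u) ∧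
      LaxBO.HasDiscreteSpectrum (LaxBO.lax u)) ∧
    -- the half-plane and the analytic dependence of the resolvent
    ∃ C₀ : ℝ, 0 < C₀ ∧ ∀ K₀ : ℝ, 0 < K₀ → LaxBO.IsProductConstant K₀ →
      ∀ u₀ : LaxBO.Sob 0 0,
        (∀ u ∈ LaxBO.logBall K₀ u₀,
          LaxBO.halfPlane C₀ u₀ ⊆ LaxBO.resolventSet (LaxBO.lax u)) ∧
        ∃ R : LaxBO.Sob (-1 / 2) 1 × ℂ → (LaxBO.Hardy (-1 / 2) →L[ℂ] LaxBO.Hardy (1 / 2)),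
          (∀ u ∈ LaxBO.logBall K₀ u₀, ∀ z ∈ LaxBO.halfPlane C₀ u₀,
            LaxBO.IsResolventAt (LaxBO.lax u) z (LaxBO.inclHardy.comp (R (u, z)))) ∧
          AnalyticOnNhd ℂ R (LaxBO.logBall K₀ u₀ ×ˢ LaxBO.halfPlane C₀ u₀) := by
  -- `ContinuousLinearMap.inverse` is total, with value `0` at non-invertible maps, so it serves as
  -- one function on the whole product; on the ball times the half-plane it is the true inverse.
  refine ⟨⟨8, by norm_num, LaxBO.isProductConstant_eight⟩, fun u => ?_, 32, by norm_num,
    fun K₀ hK0 hK u₀ => ⟨fun u hu z hz => ?_, fun p => (LaxBO.laxSub p).inverse,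
      fun u hu z hz => ?_, ?_⟩⟩
  · obtain ⟨z, R, hR, hc⟩ := LaxBO.exists_isResolventAt u
    exact ⟨LaxBO.domain_lax u, hR.isClosed, hR.hasCompactResolvent hc, hR.hasDiscreteSpectrum hc⟩
  · obtain ⟨R, h1, h2⟩ := LaxBO.exists_inverse_laxSub hK0 hK u₀ hu hz
    exact ⟨_, LaxBO.isResolventAt_of_inverse h1 h2⟩
  · obtain ⟨R, h1, h2⟩ := LaxBO.exists_inverse_laxSub hK0 hK u₀ hu hz
    beta_reduce
    rw [LaxBO.inverse_eq_of_inverse h1 h2]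
    exact LaxBO.isResolventAt_of_inverse h1 h2
  · rintro ⟨u, z⟩ ⟨hu, hz⟩
    obtain ⟨R, h1, h2⟩ := LaxBO.exists_inverse_laxSub hK0 hK u₀ hu hz
    exact LaxBO.analyticAt_inverse_of_inverse h1 h2 (LaxBO.analyticAt_laxSub (u, z))
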